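/- Let $K$ be a finite extension of $\mathbb{Q}_p$ (for some prime $p$) with valuation ring $R$, residue field $k$ and prime element $\pi$, and let $V$ be an $n$-dimensional $K$-vector space. *Intersection pairing.* Let $M$ be an $R$-lattice of full rank in $V$ and $\mathbb{P}(M)=\operatorname{Proj}\operatorname{Sym}_R(M^*)$. For a $K$-rational point $a$ and a hyperplane $H\not\ni a$ of $\mathbb{P}(V)$ let $\langle \bar a,\bar H\rangle=\sum_P \operatorname{length}_{\mathcal{O}_P}\bigl(\mathcal{O}_P/(I_{\bar a,P}+I_{\bar H,P})\bigr)\,[\kappa(P):k]$ be the intersection number on $\mathbb{P}(M)$ of their closures, where $P$ runs through the points of $\bar a\cap\bar H$ (they lie in the special fibre), and let $\langle a-b,H_C-H_D\rangle=\langle\bar a,\bar H_C\rangle-\langle\bar a,\bar H_D\rangle-\langle\bar b,\bar H_C\rangle+\langle\bar b,\bar H_D\rangle$. *Building.* The vertices of the Bruhat–Tits building of $PGL(V)$ are the classes $\{L\}$ of full rank $R$-lattices $L\subset V$ up to factors in $K^\times$; two different classes are adjacent if they have representatives with $\pi L'\subset L\subset L'$; $\operatorname{dist}$ denotes the number of edges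 of a shortest path. If $V=W\oplus W'$ with $W,W'\ne 0$ and $L\subset W$, $L'\subset W'$ are lattices of full rank in these subspaces, the geodesic corresponding to $L$ and $L'$, oriented from $W$ to $W'$, is the path $\gamma$ with the vertices $\gamma(j)=\{L\oplus\pi^{-j}L'\}$, $j\in\mathbb{Z}$. For a vertex $x$ and a subspace $0\neq W\subsetneq V$ let $[x,y_W]$ be the half-geodesic from $x$ to the boundary vertex $y_W$ given by $W$: if $x=\{\sum_i Rw_i\}$ for a basis $(w_i)$ of $V$ such that $W$ is spanned by $w_1,\dots,w_r$, its vertices are $\{\sum_{i\le r}Rw_i+\pi^m\sum_{i>r}Rw_i\}$, $m\ge 0$. Let $W*\gamma$ be the first vertex $x$ on the oriented geodesic $\gamma$ such that $[x,y_W]$ meets $\gamma$ only in $x$, and for vertices $x,y$ of $\gamma$ let $\operatorname{distor}_\gamma(x,y)$ be $\operatorname{dist}(x,y)$ if $x$ does not come after $y$ on $\gamma$, and $-\operatorname{dist}(x,y)$ otherwise. **Corollary 3.2.** Let $a\neq b$ be points in $\mathbb{P}(V)(K)$, corresponding to lines $A,B\subset V$, and let $H_C=\mathbb{P}(C)\neq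 H_D=\mathbb{P}(D)$ be hyperplanes in $\mathbb{P}(V)$, given by subspaces $C,D$ of codimension $1$, such that the cycles $a-b$ and $H_C-H_D$ have disjoint supports. Let $\langle A,B\rangle=A+B$. Then, for every choice of the lattice $M$ that is used to compute the pairing: 1. If $\langle A,B\rangle\cap C=\langle A,B\rangle\cap D$, then $\langle a-b,H_C-H_D\rangle=0$. 2. Otherwise, let $N$, $M_1$, $M_2$ be any full rank lattices in $C\cap D$, $\langle A,B\rangle\cap C$ and $\langle A,B\rangle\cap D$, respectively. Then the sum $N+M_1$ is direct and is a lattice of full rank in $C$, and $V=C\oplus(\langle A,B\rangle\cap D)$. If $\gamma$ is the geodesic corresponding to $N\oplus M_1$ and $M_2$, oriented from $C$ to $\langle A,B\rangle\cap D$, then $a*\gamma:=A*\gamma$ and $b*\gamma:=B*\gamma$ exist, and $$\langle a-b,H_C-H_D\rangle=\operatorname{distor}_\gamma(a*\gamma,b*\gamma).$$ -/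

import Mathlib

open scoped Pointwise LinearAlgebra.Projectivization ValuativeRel

/-! ### The model `ℙ(M)` of projective space and local intersection numbers

`R` is a discrete valuation ring with fraction field `K`, `V` is a `K`-vector space with basis
`e₁, …, eₙ`, and `M = R e₁ + … + R eₙ` is the lattice that it spans.  Then `Sym_R (M^*)` is the
polynomial ring `R[X₁, …, Xₙ]` (`Xᵢ` being the `i`-th coordinate function) and
`ℙ(M) = Proj R[X₁, …, Xₙ]` is a smooth projective model of `ℙ(V)` over `R`. -/

noncomputable section

attribute [instance] MvPolynomial.gradedAlgebra

namespace ProjectiveModel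

/-- The set of points of the scheme `ℙ(M) = Proj R[X₁, …, Xₙ]`. -/
abbrev Point (R : Type*) [CommRing R] (n : ℕ) : Type _ :=
  ProjectiveSpectrum (MvPolynomial.homogeneousSubmodule (Fin n) R)

/-- The local ring `𝒪_P` of `ℙ(M)` at the point `P`: the fractions `F / G` of homogeneous
polynomials of the same degree with `G ∉ P`. -/
abbrev Stalk {R : Type*} [CommRing R] {n : ℕ} (P : Point R n) : Type _ :=
  HomogeneousLocalization.AtPrime (MvPolynomial.homogeneousSubmodule (Fin n) R)
    P.asHomogeneousIdeal.toIdeal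

/-- The structure map `R → 𝒪_P`. -/
def structureMap {R : Type*} [CommRing R] {n : ℕ} (P : Point R n) : R →+* Stalk P :=
  (HomogeneousLocalization.fromZeroRingHom (MvPolynomial.homogeneousSubmodule (Fin n) R)
    P.asHomogeneousIdeal.toIdeal.primeCompl).comp
    (algebraMap R (MvPolynomial.homogeneousSubmodule (Fin n) R 0))

/-- The degree `[κ(P) : k]` of the residue field of a point `P` of the special fibre over the
residue field `k` of `R` (in general, over the residue field of the image of `P` in `Spec R`). -/
def residueDegree {R : Type*} [CommRing R] {n : ℕ} (P : Point R n) : ℕ :=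
  letI : Algebra R (Stalk P) := (structureMap P).toAlgebra
  (IsLocalRing.maximalIdeal (Stalk P)).inertiaDeg R

/-- The ideal of `𝒪_P` that a homogeneous ideal `I` of `R[X₁, …, Xₙ]` defines: the degree zero
part of the localization of `I`. -/
def stalkIdeal {R : Type*} [CommRing R] {n : ℕ} (P : Point R n)
    (I : Ideal (MvPolynomial (Fin n) R)) : Ideal (Stalk P) :=
  (I.map (algebraMap (MvPolynomial (Fin n) R)
    (Localization.AtPrime P.asHomogeneousIdeal.toIdeal))).comap
    (algebraMap (Stalk P) (Localization.AtPrime P.asHomogeneousIdeal.toIdeal))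

/-- The homogeneous ideal of the closure in `ℙ(M)` of the linear subspace `ℙ(W)` of `ℙ(V)`:
all polynomials over `R` in the coordinates with respect to `e` that vanish on `W`. -/
def closureIdeal (R : Type*) {K V : Type*} [CommRing R] [Field K] [Algebra R K] [AddCommGroup V]
    [Module K V] {n : ℕ} (e : Module.Basis (Fin n) K V) (W : Submodule K V) :
    Ideal (MvPolynomial (Fin n) R) where
  carrier := {F | ∀ v ∈ W, MvPolynomial.aeval (fun i => e.repr v i) F = 0}
  zero_mem' := fun v _ => by simp
  add_mem' := fun {F G} hF hG v hv => by simp [hF v hv, hG v hv]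
  smul_mem' := fun F G hG v hv => by simp [hG v hv]

/-- The local intersection number on `ℙ(M)` of the closure `Y` of the `K`-rational point `ℙ(A)`
and the closure `Z` of the hyperplane `ℙ(C)`, i.e. the degree of the intersection cycle `Y · Z` of
the integral curve `Y` with the effective Cartier divisor `Z`,
`∑_P length_{𝒪_P} (𝒪_P / (I_{Y,P} + I_{Z,P})) · [κ(P) : k]`.
If `ℙ(A) ∉ ℙ(C)`, then `Y ∩ Z` lies in the special fibre, and the other points contribute `0`. -/
def intersectionNumber (R : Type*) {K V : Type*} [CommRing R] [Field K] [Algebra R K]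
    [AddCommGroup V] [Module K V] {n : ℕ} (e : Module.Basis (Fin n) K V)
    (A C : Submodule K V) : ℕ :=
  ∑ᶠ P : Point R n,
    (Module.length (Stalk P)
      (Stalk P ⧸ (stalkIdeal P (closureIdeal R e A) ⊔ stalkIdeal P (closureIdeal R e C)))).toNat
      * residueDegree P

/-- The pairing `⟨ℙ(A) - ℙ(B), ℙ(C) - ℙ(D)⟩`, computed on the model `ℙ(M)`. -/
def localPairing (R : Type*) {K V : Type*} [CommRing R] [Field K] [Algebra R K]
    [AddCommGroup V] [Module K V] {n : ℕ} (e : Module.Basis (Fin n) K V)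
    (A B C D : Submodule K V) : ℤ :=
  (intersectionNumber R e A C : ℤ) - intersectionNumber R e A D
    - intersectionNumber R e B C + intersectionNumber R e B D

end ProjectiveModel

/-! ### The Bruhat-Tits building of `PGL(V)`: vertices, edges, apartments, geodesics -/

namespace BruhatTits

/-- `L` is an `R`-lattice of full rank in the subspace `W` of `V`: a finitely generated
`R`-submodule of `V` whose `K`-span is `W`. -/
def IsLatticeIn {R K V : Type*} [CommRing R] [Field K] [Algebra R K] [AddCommGroup V]
    [Module K V] [Module R V] [IsScalarTower R K V]
    (L : Submodule R V) (W : Submodule K V) : Prop :=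
  L.FG ∧ Submodule.span K (L : Set V) = W

section

variable {R K V : Type*} [CommRing R] [Field K] [Algebra R K] [AddCommGroup V]
  [Module K V] [Module R V] [IsScalarTower R K V]

theorem IsLatticeIn.smul {L : Submodule R V} {W : Submodule K V} (h : IsLatticeIn L W)
    {c : K} (hc : c ≠ 0) : IsLatticeIn (c • L) W := by
  obtain ⟨hf, rfl⟩ := h
  refine ⟨hf.map _, le_antisymm (Submodule.span_le.2 ?_) (Submodule.span_le.2 fun x hx => ?_)⟩
  · rintro _ ⟨x, hx, rfl⟩
    exact Submodule.smul_mem _ c (Submodule.subset_span hx)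
  · have h1 : c • x ∈ Submodule.span K ((c • L : Submodule R V) : Set V) :=
      Submodule.subset_span (Submodule.smul_mem_pointwise_smul x c L hx)
    have h2 := Submodule.smul_mem _ c⁻¹ h1
    rwa [inv_smul_smul₀ hc] at h2

theorem IsLatticeIn.sup {L L' : Submodule R V} {W W' : Submodule K V} (h : IsLatticeIn L W)
    (h' : IsLatticeIn L' W') : IsLatticeIn (L ⊔ L') (W ⊔ W') := by
  obtain ⟨hf, rfl⟩ := h
  obtain ⟨hf', rfl⟩ := h'
  refine ⟨hf.sup hf', le_antisymm (Submodule.span_le.2 fun x hx => ?_) (sup_le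
    (Submodule.span_mono (SetLike.coe_subset_coe.2 le_sup_left))
    (Submodule.span_mono (SetLike.coe_subset_coe.2 le_sup_right)))⟩
  obtain ⟨y, hy, z, hz, rfl⟩ := Submodule.mem_sup.1 hx
  exact Submodule.add_mem_sup (Submodule.subset_span hy) (Submodule.subset_span hz)

theorem isLatticeIn_span {ι : Type*} [Finite ι] (w : ι → V) (W : Submodule K V)
    (hw : Submodule.span K (Set.range w) = W) :
    IsLatticeIn (Submodule.span R (Set.range w)) W := by
  subst hw
  refine ⟨Submodule.fg_span (Set.finite_range w), le_antisymm ?_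
    (Submodule.span_mono Submodule.subset_span)⟩
  exact Submodule.span_le.2 (Submodule.span_le_restrictScalars R K (Set.range w))

theorem span_range_smul_eq_top {ι : Type*} (w : Module.Basis ι K V) {c : ι → K}
    (hc : ∀ i, c i ≠ 0) : Submodule.span K (Set.range fun i => c i • w i) = ⊤ := by
  rw [eq_top_iff, ← w.span_eq, Submodule.span_le]
  rintro _ ⟨i, rfl⟩
  have h := Submodule.smul_mem (Submodule.span K (Set.range fun i => c i • w i))
    (c i)⁻¹ (Submodule.subset_span ⟨i, rfl⟩)
  rwa [inv_smul_smul₀ (hc i)] at h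

theorem algebraMap_zpow_ne_zero [IsDomain R] [IsFractionRing R K] {ϖ : R} (hϖ : Irreducible ϖ)
    (k : ℤ) : algebraMap R K ϖ ^ k ≠ 0 :=
  zpow_ne_zero k (by simpa using hϖ.ne_zero)

end

/-- The `R`-lattices of full rank in `V`. -/
def FullLattice (R K V : Type*) [CommRing R] [Field K] [Algebra R K] [AddCommGroup V]
    [Module K V] [Module R V] [IsScalarTower R K V] : Type _ :=
  {L : Submodule R V // IsLatticeIn L (⊤ : Submodule K V)}

/-- Two lattices are equivalent if they differ by a factor in `K^×`. -/
def latticeSetoid (R K V : Type*) [CommRing R] [Field K] [Algebra R K] [AddCommGroup V]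
    [Module K V] [Module R V] [IsScalarTower R K V] : Setoid (FullLattice R K V) where
  r L L' := ∃ c : K, c ≠ 0 ∧ L'.1 = c • L.1
  iseqv :=
    { refl := fun L => ⟨1, one_ne_zero, by simp⟩
      symm := fun {L L'} ⟨c, hc, h⟩ =>
        ⟨c⁻¹, inv_ne_zero hc, by rw [h, ← mul_smul, inv_mul_cancel₀ hc, one_smul]⟩
      trans := fun {L L' L''} ⟨c, hc, h⟩ ⟨d, hd, h'⟩ =>
        ⟨d * c, mul_ne_zero hd hc, by rw [h', h, mul_smul]⟩ }

/-- The vertices of the building of `PGL(V)`: the lattice classes `{L}`. -/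
def Vertex (R K V : Type*) [CommRing R] [Field K] [Algebra R K] [AddCommGroup V]
    [Module K V] [Module R V] [IsScalarTower R K V] : Type _ :=
  Quotient (latticeSetoid R K V)

/-- The class `{L}` of a full lattice `L`. -/
def vertex {R K V : Type*} [CommRing R] [Field K] [Algebra R K] [AddCommGroup V]
    [Module K V] [Module R V] [IsScalarTower R K V] (L : Submodule R V)
    (hL : IsLatticeIn L (⊤ : Submodule K V)) : Vertex R K V :=
  Quotient.mk (latticeSetoid R K V) ⟨L, hL⟩

/-- The 1-skeleton of the building: two different lattice classes are adjacent if they have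
representatives `L` and `L'` with `π L' ⊆ L ⊆ L'`.  (This relation is symmetric.) -/
def skeleton (R K V : Type*) [CommRing R] [IsLocalRing R] [Field K] [Algebra R K]
    [AddCommGroup V] [Module K V] [Module R V] [IsScalarTower R K V] :
    SimpleGraph (Vertex R K V) :=
  SimpleGraph.fromRel fun x y => ∃ (L L' : Submodule R V)
    (hL : IsLatticeIn L (⊤ : Submodule K V)) (hL' : IsLatticeIn L' (⊤ : Submodule K V)),
    vertex L hL = x ∧ vertex L' hL' = y ∧ IsLocalRing.maximalIdeal R • L' ≤ L ∧ L ≤ L'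

/-- The combinatorial distance of two vertices: the minimal number of edges of a path. -/
def dist {R K V : Type*} [CommRing R] [IsLocalRing R] [Field K] [Algebra R K]
    [AddCommGroup V] [Module K V] [Module R V] [IsScalarTower R K V] (x y : Vertex R K V) : ℕ :=
  (skeleton R K V).dist x y

/-- The vertices of the apartment that belongs to a basis `w` of `V`: the vertex with coordinates
`k ∈ ℤ^n` is the class of the lattice `∑ π^{k_i} R w_i`. -/
def apartmentVertex {R K V : Type*} [CommRing R] [IsDomain R] [Field K] [Algebra R K]
    [IsFractionRing R K] [AddCommGroup V] [Module K V] [Module R V] [IsScalarTower R K V]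
    {ϖ : R} (hϖ : Irreducible ϖ) {n : ℕ} (w : Module.Basis (Fin n) K V) (k : Fin n → ℤ) :
    Vertex R K V :=
  vertex (Submodule.span R (Set.range fun i => algebraMap R K ϖ ^ k i • w i))
    (isLatticeIn_span _ _ (span_range_smul_eq_top w fun i => algebraMap_zpow_ne_zero hϖ (k i)))

open Classical in
/-- The set of vertices of the half-geodesic `[x, y_W]` from the vertex `x` to the boundary vertex
`y_W` of a non-trivial subspace `W` of `V`.  Take an apartment that contains `x` and whose boundary
contains `y_W`, i.e. a basis `w` such that `W` is spanned by the `w_i` with `i` in some index set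
`s`.  In this apartment, `[x, y_W]` is the half-line that starts in `x` and runs in the direction
of the sum of the cocharacters `η_i`, `i ∈ s`; it is a path of edges, and its `m`-th vertex arises
from `x` by lowering the coordinates with index in `s` by `m`.  For `x = {∑ R w_i}` these are the
classes of `∑_{i ∈ s} R w_i + π^m ∑_{i ∉ s} R w_i`, for `m ≥ 0`. -/
def halfGeodesic {R K V : Type*} [CommRing R] [IsDomain R] [Field K] [Algebra R K]
    [IsFractionRing R K] [AddCommGroup V] [Module K V] [Module R V] [IsScalarTower R K V]
    {ϖ : R} (hϖ : Irreducible ϖ) (x : Vertex R K V) (W : Submodule K V) : Set (Vertex R K V) :=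
  {y | ∃ (w : Module.Basis (Fin (Module.finrank K V)) K V) (s : Set (Fin (Module.finrank K V)))
    (k : Fin (Module.finrank K V) → ℤ) (m : ℕ),
    Submodule.span K (w '' s) = W ∧ x = apartmentVertex hϖ w k ∧
      y = apartmentVertex hϖ w fun i => if i ∈ s then k i - m else k i}

/-- The combinatorial geodesic that corresponds to a pair of lattices `L` in `W` and `L'` in `W'`,
where `V = W ⊕ W'`.  It consists of the vertices `{L + π^k L'}`, `k ∈ ℤ`, and the edges between
them.  As `k → ∞` it converges to the boundary vertex `y_W`, as `k → -∞` to `y_{W'}`; it is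
oriented from `W` to `W'`, so that its `j`-th vertex is `{L + π^{-j} L'}`. -/
def geodesic {R K V : Type*} [CommRing R] [IsDomain R] [Field K] [Algebra R K]
    [IsFractionRing R K] [AddCommGroup V] [Module K V] [Module R V] [IsScalarTower R K V]
    {ϖ : R} (hϖ : Irreducible ϖ) {W W' : Submodule K V} (hW : IsCompl W W')
    {L L' : Submodule R V} (hL : IsLatticeIn L W) (hL' : IsLatticeIn L' W') (j : ℤ) :
    Vertex R K V :=
  vertex (L ⊔ algebraMap R K ϖ ^ (-j) • L')
    (hW.sup_eq_top ▸ hL.sup (hL'.smul (algebraMap_zpow_ne_zero hϖ _)))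

/-- `x = W ∗ γ`: on the oriented geodesic `γ`, `x` is the first vertex such that the half-geodesic
`[x, y_W]` meets `γ` only in `x`.  (Half-geodesics from vertices and `γ` are paths of edges, so
they meet only in `x` if and only if they have no other vertex in common.) -/
def IsClosestVertex {R K V : Type*} [CommRing R] [IsDomain R] [Field K] [Algebra R K]
    [IsFractionRing R K] [AddCommGroup V] [Module K V] [Module R V] [IsScalarTower R K V]
    {ϖ : R} (hϖ : Irreducible ϖ) (γ : ℤ → Vertex R K V) (W : Submodule K V)
    (x : Vertex R K V) : Prop :=
  ∃ j : ℤ, γ j = x ∧ IsLeast {i : ℤ | halfGeodesic hϖ (γ i) W ∩ Set.range γ = {γ i}} j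

open Classical in
/-- The oriented distance of two vertices `x`, `y` on an oriented geodesic `γ`: their combinatorial
distance if `x` does not come after `y`, and minus this distance otherwise. -/
def distor {R K V : Type*} [CommRing R] [IsLocalRing R] [Field K] [Algebra R K]
    [AddCommGroup V] [Module K V] [Module R V] [IsScalarTower R K V]
    (γ : ℤ → Vertex R K V) (x y : Vertex R K V) : ℤ :=
  if ∃ i j : ℤ, i ≤ j ∧ γ i = x ∧ γ j = y then (dist x y : ℤ) else -(dist x y : ℤ)

end BruhatTits

end

/-! Both sides are the valuation of a cross ratio. Let `φ`, `ψ` be linear forms with kernels `C`,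
`D`, and let `v`, `w` span `A`, `B`.

On the model, scale `v` and `φ` to coordinate vectors `α`, `c` over `R` that have an entry `1`. The
closure of the point is a section of `ℙ(M)` over `R`: modulo its ideal every element of the local
ring at its special point is a constant from `R`, and the equation of the hyperplane becomes `c(α)`.
The intersection is therefore `R/(c(α))`, with residue degree one where it is nonempty
(`intersectionNumber_eq`). In the alternating sum all scaling factors cancel, and what remains is
the order of `φ(v)ψ(w)/(φ(w)ψ(v))`, whatever `M` is (`localPairing_eq_of_hasOrder`). If `A + B`
meets `C` and `D` in the same line, this cross ratio is `1`.

Otherwise `M₁ = R x₁` and `M₂ = R x₂`, and `V` is the sum of `C ∩ D`, `K x₁` and `K x₂`, so that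
`γ(j)` is the class of `N + R x₁ + ϖ^{-j} R x₂`. A point of the plane off `D` is the line of `x₁ + u
x₂` with `u = φ(z)ψ(x₁)/(φ(x₂)ψ(z))`. At `γ(-ord u)` the two summands of this vector have equal
weight and the half-geodesic leaves `γ` at once; before that vertex `u x₂` dominates and the
half-geodesic first follows `γ` (`IsFrame.isClosestVertex`). Indices along `γ` measure distance
(`IsFrame.distor_geodesic`), so the oriented distance is `ord u_v - ord u_w`, and `u_v / u_w` is the
same cross ratio. -/

noncomputable section

namespace ProjectiveModel

/-! ### Restriction of polynomials to a line -/

section LineEval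

variable {R : Type*} [CommRing R] {n : ℕ}

/-- The restriction of polynomials to the line through `α`: the `R`-algebra homomorphism
`R[X₁, …, Xₙ] → R[t]` with `Xᵢ ↦ αᵢ t`. -/
def lineEval (α : Fin n → R) : MvPolynomial (Fin n) R →ₐ[R] Polynomial R :=
  MvPolynomial.aeval fun i => Polynomial.C (α i) * Polynomial.X

theorem lineEval_of_isHomogeneous (α : Fin n → R) {F : MvPolynomial (Fin n) R} {d : ℕ}
    (hF : F.IsHomogeneous d) :
    lineEval α F = Polynomial.C (MvPolynomial.eval α F) * Polynomial.X ^ d := by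
  rw [lineEval, MvPolynomial.aeval_def, MvPolynomial.eval₂_eq', MvPolynomial.eval_eq', map_sum,
    Finset.sum_mul]
  refine Finset.sum_congr rfl fun m hm => ?_
  have hd : ∑ i, m i = d := by
    have := hF (MvPolynomial.mem_support_iff.1 hm)
    rw [← this, Finsupp.weight_apply, Finsupp.sum_fintype _ _ (by simp)]
    exact Finset.sum_congr rfl fun i _ => (mul_one (m i)).symm
  rw [map_mul, map_prod, mul_assoc, Polynomial.algebraMap_eq, ← hd, ← Finset.prod_pow_eq_pow_sum,
    ← Finset.prod_mul_distrib]
  exact congrArg _ (Finset.prod_congr rfl fun i _ => by rw [mul_pow, map_pow])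

theorem lineEval_coeff (α : Fin n → R) (F : MvPolynomial (Fin n) R) (d : ℕ) :
    (lineEval α F).coeff d = MvPolynomial.eval α (MvPolynomial.homogeneousComponent d F) := by
  conv_lhs => rw [← MvPolynomial.sum_homogeneousComponent F]
  rw [map_sum, Polynomial.finsetSum_coeff]
  simp only [lineEval_of_isHomogeneous α (MvPolynomial.homogeneousComponent_isHomogeneous _ F),
    Polynomial.coeff_C_mul, Polynomial.coeff_X_pow, mul_ite, mul_one, mul_zero]
  rw [Finset.sum_ite_eq]
  split_ifs with h
  · rfl
  · rw [MvPolynomial.homogeneousComponent_eq_zero _ _ (by simpa using h), map_zero]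

theorem eval_lineEval {S : Type*} [CommRing S] [Algebra R S] (α : Fin n → R)
    (F : MvPolynomial (Fin n) R) (t : S) :
    Polynomial.aeval t (lineEval α F) =
      MvPolynomial.aeval (fun i => t * algebraMap R S (α i)) F := by
  rw [lineEval, ← AlgHom.comp_apply, MvPolynomial.comp_aeval]
  congr 2
  funext i
  rw [map_mul, Polynomial.aeval_C, Polynomial.aeval_X, mul_comm]

/-- Polynomial evaluation respects congruences. This allows a point to be moved onto a hyperplane at
the cost of an error in `I`. -/
theorem lineEval_sub_mem (α α' : Fin n → R) (I : Ideal R) (h : ∀ i, α i - α' i ∈ I)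
    (F : MvPolynomial (Fin n) R) (d : ℕ) :
    (lineEval α F).coeff d - (lineEval α' F).coeff d ∈ I := by
  rw [lineEval_coeff, lineEval_coeff, ← Ideal.Quotient.eq]
  set G := MvPolynomial.homogeneousComponent d F
  have key : ∀ β : Fin n → R, Ideal.Quotient.mk I (MvPolynomial.eval β G) =
      MvPolynomial.eval₂ (Ideal.Quotient.mk I) (fun i => Ideal.Quotient.mk I (β i)) G := by
    intro β
    rw [MvPolynomial.eval, MvPolynomial.coe_eval₂Hom, MvPolynomial.eval₂_comp_left]
    rfl
  rw [key, key]
  congr 1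
  funext i
  exact Ideal.Quotient.eq.2 (h i)

end LineEval

/-! ### The reduction of a rational point -/

section SpecialPoint

variable {R : Type*} [CommRing R] [IsLocalRing R] {n : ℕ}

/-- The point of the special fibre through which the closure of the point with primitive
coordinates `α` passes. -/
def specialPoint (α : Fin n → R) (i₀ : Fin n) (hα : α i₀ = 1) : Point R n where
  asHomogeneousIdeal :=
    { toSubmodule := ((IsLocalRing.maximalIdeal R).map Polynomial.C).comap (lineEval α)
      is_homogeneous' := by
        -- The coefficient of `t^d` depends only on the component of degree `d`, so membership can
        -- be tested degree by degree.
        intro d F hF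
        simp only [Ideal.mem_comap, Ideal.mem_map_C_iff, lineEval_coeff] at hF ⊢
        intro d'
        have : ((DirectSum.decompose (MvPolynomial.homogeneousSubmodule (Fin n) R) F d :
            MvPolynomial (Fin n) R)) = MvPolynomial.homogeneousComponent d F :=
          MvPolynomial.decomposition.decompose'_apply F d
        rw [this, MvPolynomial.homogeneousComponent_of_mem
          (MvPolynomial.homogeneousComponent_isHomogeneous d F)]
        split_ifs with h
        · exact hF d
        · simp }
  isPrime := by
    have : ((IsLocalRing.maximalIdeal R).map (Polynomial.C : R →+* Polynomial R)).IsPrime :=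
      inferInstance
    exact Ideal.comap_isPrime (lineEval α) _
  not_irrelevant_le := by
    intro h
    have h1 : (MvPolynomial.X i₀ : MvPolynomial (Fin n) R) ∈
        HomogeneousIdeal.irrelevant (MvPolynomial.homogeneousSubmodule (Fin n) R) := by
      rw [HomogeneousIdeal.mem_irrelevant_iff, GradedRing.proj_apply]
      exact DirectSum.decompose_of_mem_ne _ (MvPolynomial.isHomogeneous_X R i₀) one_ne_zero
    have h2 := h h1
    change lineEval α (MvPolynomial.X i₀) ∈ (IsLocalRing.maximalIdeal R).map Polynomial.C at h2
    rw [Ideal.mem_map_C_iff] at h2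
    have h3 := h2 1
    simp [lineEval, hα] at h3

theorem mem_specialPoint {α : Fin n → R} {i₀ : Fin n} {hα : α i₀ = 1}
    {F : MvPolynomial (Fin n) R} :
    F ∈ (specialPoint α i₀ hα).asHomogeneousIdeal.toIdeal ↔
      ∀ d, (lineEval α F).coeff d ∈ IsLocalRing.maximalIdeal R :=
  Ideal.mem_map_C_iff

end SpecialPoint

/-! ### Ideals of closures of linear subspaces -/

section ClosureIdeal

variable {R K V : Type*} [CommRing R] [Field K] [Algebra R K] [AddCommGroup V] [Module K V] {n : ℕ} (e : Module.Basis (Fin n) K V)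

/-- The restriction of `F` has every `t` in the infinite field `K` as a zero. -/
theorem lineEval_eq_zero_of_mem_closureIdeal [Infinite K] [IsFractionRing R K] {W : Submodule K V} {α : Fin n → R}
    (hα : ∑ i, algebraMap R K (α i) • e i ∈ W) {F : MvPolynomial (Fin n) R}
    (hF : F ∈ closureIdeal R e W) : lineEval α F = 0 := by
  apply Polynomial.map_injective (algebraMap R K) (IsFractionRing.injective R K)
  rw [Polynomial.map_zero]
  refine Polynomial.funext fun t => ?_
  have h := hF _ (W.smul_mem t hα)
  rw [Polynomial.eval_zero, Polynomial.eval_map_algebraMap, eval_lineEval, ← h]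
  congr 2
  funext i
  simp [Finsupp.single_apply, Module.Basis.repr_self, Algebra.smul_def, mul_comm]

theorem mem_closureIdeal_of_isHomogeneous {A : Submodule K V} {α : Fin n → R}
    (hA : A = Submodule.span K {∑ i, algebraMap R K (α i) • e i})
    {F : MvPolynomial (Fin n) R} {d : ℕ} (hF : F.IsHomogeneous d)
    (h : MvPolynomial.eval α F = 0) : F ∈ closureIdeal R e A := by
  intro v hv
  rw [hA] at hv
  obtain ⟨t, rfl⟩ := Submodule.mem_span_singleton.1 hv
  have h1 : (fun i => e.repr (t • ∑ i, algebraMap R K (α i) • e i) i) =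
      fun i => t * algebraMap R K (α i) := by
    funext i
    simp [Finsupp.single_apply, Module.Basis.repr_self, Algebra.smul_def, mul_comm]
  rw [h1, ← eval_lineEval, lineEval_of_isHomogeneous α hF, h]
  simp

end ClosureIdeal

/-! ### Local rings of the model -/

section Stalk

variable {R : Type*} [CommRing R] {n : ℕ} {P : Point R n}

theorem val_structureMap (r : R) : (structureMap P r).val =
    algebraMap (MvPolynomial (Fin n) R) (Localization.AtPrime P.asHomogeneousIdeal.toIdeal)
      (MvPolynomial.C r) := by
  rw [← Localization.mk_one_eq_algebraMap]
  rfl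

theorem mem_stalkIdeal_iff {I : Ideal (MvPolynomial (Fin n) R)} {x : Stalk P} :
    x ∈ stalkIdeal P I ↔ x.val ∈ I.map (algebraMap (MvPolynomial (Fin n) R)
      (Localization.AtPrime P.asHomogeneousIdeal.toIdeal)) := Iff.rfl

theorem isUnit_algebraMap {s : MvPolynomial (Fin n) R}
    (hs : s ∉ P.asHomogeneousIdeal.toIdeal) : IsUnit (algebraMap (MvPolynomial (Fin n) R)
      (Localization.AtPrime P.asHomogeneousIdeal.toIdeal) s) :=
  IsLocalization.map_units (Localization.AtPrime P.asHomogeneousIdeal.toIdeal)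
    (⟨s, hs⟩ : P.asHomogeneousIdeal.toIdeal.primeCompl)

theorem mk_sub_structureMap_mem_stalkIdeal {I : Ideal (MvPolynomial (Fin n) R)}
    {x : HomogeneousLocalization.NumDenSameDeg (MvPolynomial.homogeneousSubmodule (Fin n) R)
      P.asHomogeneousIdeal.toIdeal.primeCompl}
    {r : R} (h : (x.num : MvPolynomial (Fin n) R) - MvPolynomial.C r * (x.den : MvPolynomial (Fin n) R) ∈ I) :
    (HomogeneousLocalization.mk x - structureMap P r : Stalk P) ∈ stalkIdeal P I := by
  rw [mem_stalkIdeal_iff, HomogeneousLocalization.val_sub, val_structureMap,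
    ← Ideal.mul_unit_mem_iff_mem _ (isUnit_algebraMap x.den_mem), sub_mul,
    HomogeneousLocalization.val_mk, Localization.mk_eq_mk',
    IsLocalization.mk'_spec_mk, ← map_mul, ← map_sub]
  exact Ideal.mem_map_of_mem _ h

theorem structureMap_mem_stalkIdeal {I : Ideal (MvPolynomial (Fin n) R)} {r : R} :
    structureMap P r ∈ stalkIdeal P I ↔
      ∃ s ∉ P.asHomogeneousIdeal.toIdeal, s * MvPolynomial.C r ∈ I := by
  rw [mem_stalkIdeal_iff, val_structureMap,
    IsLocalization.algebraMap_mem_map_algebraMap_iff P.asHomogeneousIdeal.toIdeal.primeCompl]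
  rfl

theorem stalkIdeal_sup_le (I I' : Ideal (MvPolynomial (Fin n) R)) :
    stalkIdeal P I ⊔ stalkIdeal P I' ≤ stalkIdeal P (I ⊔ I') :=
  sup_le (Ideal.comap_mono (Ideal.map_mono le_sup_left))
    (Ideal.comap_mono (Ideal.map_mono le_sup_right))

/-- An element of `I` outside `P` becomes a unit in the full localization. Since `stalkIdeal` is
contracted from there, no fraction of degree zero has to be formed. -/
theorem le_of_stalkIdeal_ne_top {I : Ideal (MvPolynomial (Fin n) R)} (h : stalkIdeal P I ≠ ⊤) :
    I ≤ P.asHomogeneousIdeal.toIdeal := by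
  intro F hF
  by_contra hP
  refine h ((Ideal.eq_top_iff_one _).2 ?_)
  rw [mem_stalkIdeal_iff, HomogeneousLocalization.val_one,
    ← Ideal.eq_top_iff_one]
  exact Ideal.eq_top_of_isUnit_mem _ (Ideal.mem_map_of_mem _ hF) (isUnit_algebraMap hP)

/-- If the structure map `R → 𝒪_P` is surjective modulo a proper ideal, then `P` is a rational
point of the special fibre. -/
theorem residueDegree_eq_one [IsLocalRing R] {J : Ideal (Stalk P)} (hJ : J ≠ ⊤)
    (h : ∀ x : Stalk P, ∃ r : R, x - structureMap P r ∈ J) : residueDegree P = 1 := by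
  let _ : Algebra R (Stalk P) := (structureMap P).toAlgebra
  set 𝔪 := IsLocalRing.maximalIdeal (Stalk P)
  have hsurj : Function.Surjective (algebraMap R (Stalk P ⧸ 𝔪)) := by
    intro y
    obtain ⟨x, rfl⟩ := Ideal.Quotient.mk_surjective y
    obtain ⟨r, hr⟩ := h x
    exact ⟨r, (Ideal.Quotient.eq.2 (IsLocalRing.le_maximalIdeal hJ hr)).symm⟩
  -- Maximality of the contraction is what turns `inertiaDeg` into the degree of the residue field
  -- extension.
  have hmax : (𝔪.under R).IsMaximal := by
    have h1 : 𝔪.under R = RingHom.ker (algebraMap R (Stalk P ⧸ 𝔪)) := by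
      ext r
      rw [RingHom.mem_ker, Ideal.under, Ideal.mem_comap,
        IsScalarTower.algebraMap_apply R (Stalk P) (Stalk P ⧸ 𝔪)]
      exact Ideal.Quotient.eq_zero_iff_mem.symm
    rw [h1]
    let _ := Ideal.Quotient.field 𝔪
    exact RingHom.ker_isMaximal_of_surjective _ hsurj
  have h2 : residueDegree P = Module.finrank (R ⧸ 𝔪.under R) (Stalk P ⧸ 𝔪) :=
    Ideal.inertiaDeg_eq_of_isMaximal (𝔪.under R) 𝔪
  rw [h2]
  let _ := Ideal.Quotient.field (𝔪.under R)
  let _ := Ideal.Quotient.field 𝔪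
  refine finrank_eq_one_iff'.2 ⟨1, one_ne_zero, fun w => ?_⟩
  obtain ⟨r, rfl⟩ := hsurj w
  refine ⟨Ideal.Quotient.mk _ r, ?_⟩
  rw [Algebra.smul_def, mul_one]
  rfl

/-- The length of a quotient of `𝒪_P` modulo which the structure map is surjective. -/
theorem length_quotient_eq_of_structureMap {J : Ideal (Stalk P)} {I : Ideal R}
    (h : ∀ x : Stalk P, ∃ r : R, x - structureMap P r ∈ J)
    (hI : ∀ r, structureMap P r ∈ J ↔ r ∈ I) :
    Module.length (Stalk P) (Stalk P ⧸ J) = Module.length R (R ⧸ I) := by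
  let _ : Algebra R (Stalk P) := (structureMap P).toAlgebra
  have hsurj : Function.Surjective (algebraMap R (Stalk P ⧸ J)) := by
    intro y
    obtain ⟨x, rfl⟩ := Ideal.Quotient.mk_surjective y
    obtain ⟨r, hr⟩ := h x
    exact ⟨r, (Ideal.Quotient.eq.2 hr).symm⟩
  have hker : I = RingHom.ker (Algebra.ofId R (Stalk P ⧸ J)) := by
    ext r
    rw [← hI, RingHom.mem_ker]
    exact Ideal.Quotient.eq_zero_iff_mem.symm
  rw [Module.length_eq_of_surjective (S := Stalk P) (R := Stalk P ⧸ J) Ideal.Quotient.mk_surjective,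
    ← Module.length_eq_of_surjective (S := R) hsurj]
  subst hker
  exact (Ideal.quotientKerAlgEquivOfSurjective (f := Algebra.ofId R (Stalk P ⧸ J))
    hsurj).toLinearEquiv.length_eq.symm

end Stalk

/-! ### Intersection of a section with a hyperplane -/

section IntersectionNumber

variable {R K V : Type*} [CommRing R] [Field K] [Algebra R K] [AddCommGroup V] [Module K V]
  {n : ℕ} {e : Module.Basis (Fin n) K V} {A C : Submodule K V} {α c : Fin n → R} {i₀ j₀ : Fin n}

theorem linearForm_mem_closureIdeal
    (hC : ∀ v, v ∈ C ↔ ∑ i, algebraMap R K (c i) * e.repr v i = 0) :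
    ∑ i, MvPolynomial.C (c i) * MvPolynomial.X i ∈ closureIdeal R e C := by
  intro v hv
  rw [map_sum, ← (hC v).1 hv]
  simp [MvPolynomial.algHom_C]

theorem isHomogeneous_linearForm (c : Fin n → R) :
    (∑ i, MvPolynomial.C (c i) * MvPolynomial.X i : MvPolynomial (Fin n) R).IsHomogeneous 1 :=
  MvPolynomial.IsHomogeneous.sum _ _ _ fun i _ => by
    simpa using (MvPolynomial.isHomogeneous_C (Fin n) (c i)).mul (MvPolynomial.isHomogeneous_X R i)

/-- Moving `α` by a multiple of `c(α)` puts it on the hyperplane, where `F` vanishes. This replaces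
a proof that the linear form generates the closure ideal. -/
theorem dvd_coeff_lineEval_of_mem_closureIdeal [Infinite K] [IsFractionRing R K] (hc : c j₀ = 1)
    (hC : ∀ v, v ∈ C ↔ ∑ i, algebraMap R K (c i) * e.repr v i = 0)
    {F : MvPolynomial (Fin n) R} (hF : F ∈ closureIdeal R e C) (d : ℕ) :
    (lineEval α F).coeff d ∈ Ideal.span {∑ i, c i * α i} := by
  set p := ∑ i, c i * α i with hp
  -- Since `c j₀ = 1`, subtracting `p = c(α)` from the coordinate `j₀` gives `c(α') = 0`.
  set α' : Fin n → R := fun i => α i - if i = j₀ then p else 0 with hα'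
  have h0 : lineEval α' F = 0 := by
    refine lineEval_eq_zero_of_mem_closureIdeal e ((hC _).2 ?_) hF
    have h1 : ∀ i, e.repr (∑ i, algebraMap R K (α' i) • e i) i = algebraMap R K (α' i) := by
      intro i
      simp [Finsupp.single_apply, Module.Basis.repr_self, Algebra.smul_def]
    simp_rw [h1, ← map_mul, ← map_sum, hα', mul_sub, Finset.sum_sub_distrib]
    simp [← hp, hc]
  have h2 := lineEval_sub_mem α α' (Ideal.span {p}) (fun i => by
    simp only [hα', sub_sub_cancel]
    split_ifs
    · exact Ideal.mem_span_singleton_self p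
    · exact Ideal.zero_mem _) F d
  simpa [h0] using h2

theorem isUnit_eval_of_notMem_specialPoint [IsLocalRing R] {hα : α i₀ = 1}
    {G : MvPolynomial (Fin n) R} {d : ℕ} (hG : G.IsHomogeneous d)
    (h : G ∉ (specialPoint α i₀ hα).asHomogeneousIdeal.toIdeal) :
    IsUnit (MvPolynomial.eval α G) := by
  by_contra hu
  refine h (mem_specialPoint.2 fun d' => ?_)
  rw [lineEval_of_isHomogeneous α hG, Polynomial.coeff_C_mul]
  exact Ideal.mul_mem_right _ _ ((IsLocalRing.mem_maximalIdeal _).2 hu)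

theorem exists_sub_structureMap_mem_stalkIdeal [IsLocalRing R] (hα : α i₀ = 1)
    (hA : A = Submodule.span K {∑ i, algebraMap R K (α i) • e i})
    (x : Stalk (specialPoint α i₀ hα)) :
    ∃ r : R, x - structureMap _ r ∈ stalkIdeal _ (closureIdeal R e A) := by
  obtain ⟨c, rfl⟩ := HomogeneousLocalization.mk_surjective x
  obtain ⟨u, hu⟩ := isUnit_eval_of_notMem_specialPoint c.den.2 c.den_mem
  -- The constant is `F(α)/G(α)`, the value of the fraction at `α`; `G(α)` is a unit because the
  -- denominator lies outside the special point.
  have key : ∀ F G : MvPolynomial (Fin n) R, F.IsHomogeneous c.deg → G.IsHomogeneous c.deg →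
      MvPolynomial.eval α G = u →
      F - MvPolynomial.C (MvPolynomial.eval α F * ↑u⁻¹) * G ∈ closureIdeal R e A := by
    intro F G hF hG hu
    refine mem_closureIdeal_of_isHomogeneous e hA (d := c.deg) (hF.sub ?_) ?_
    · simpa only [zero_add] using
        (MvPolynomial.isHomogeneous_C (Fin n) (MvPolynomial.eval α F * ↑u⁻¹)).mul hG
    · rw [map_sub, map_mul, MvPolynomial.eval_C, hu, mul_assoc, Units.inv_mul, mul_one, sub_self]
  have h := key c.num c.den ((MvPolynomial.mem_homogeneousSubmodule _ _).1 c.num.2)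
    ((MvPolynomial.mem_homogeneousSubmodule _ _).1 c.den.2) hu.symm
  exact ⟨_, mk_sub_structureMap_mem_stalkIdeal h⟩

/-- Restriction to the line of `α` kills the ideal of `A` and sends that of `C` to polynomials with
coefficients in `(c(α))`, which gives one direction. Conversely, the fraction `c(X)/X_{i₀}` lies in
the ideal of `C` and is congruent to `c(α)` modulo that of `A`. -/
theorem structureMap_mem_stalkIdeal_sup_iff [IsLocalRing R] [Infinite K] [IsFractionRing R K]
    (hα : α i₀ = 1) (hc : c j₀ = 1)
    (hA : A = Submodule.span K {∑ i, algebraMap R K (α i) • e i})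
    (hC : ∀ v, v ∈ C ↔ ∑ i, algebraMap R K (c i) * e.repr v i = 0) (r : R) :
    structureMap (specialPoint α i₀ hα) r ∈
      stalkIdeal (specialPoint α i₀ hα) (closureIdeal R e A) ⊔
        stalkIdeal (specialPoint α i₀ hα) (closureIdeal R e C) ↔
      r ∈ Ideal.span {∑ i, c i * α i} := by
  constructor
  · intro h
    obtain ⟨s, hs, hr⟩ := structureMap_mem_stalkIdeal.1 (stalkIdeal_sup_le _ _ h)
    obtain ⟨F, hF, G, hG, hFG⟩ := Submodule.mem_sup.1 hr
    rw [mem_specialPoint, not_forall] at hs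
    obtain ⟨d, hd⟩ := hs
    -- A denominator outside the special point has a unit among the coefficients of its restriction,
    -- and this coefficient can be cancelled.
    have hu : IsUnit ((lineEval α s).coeff d) := by
      by_contra hu
      exact hd ((IsLocalRing.mem_maximalIdeal _).2 hu)
    have h1 : lineEval α (s * MvPolynomial.C r) = lineEval α G := by
      rw [← hFG, map_add, lineEval_eq_zero_of_mem_closureIdeal e (W := A)
        (hA ▸ Submodule.mem_span_singleton_self _) hF, zero_add]
    have h2 := dvd_coeff_lineEval_of_mem_closureIdeal (α := α) hc hC hG d
    rw [← h1, map_mul, show lineEval α (MvPolynomial.C r) = Polynomial.C r from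
      MvPolynomial.algHom_C _ r, Polynomial.coeff_mul_C] at h2
    exact (Ideal.unit_mul_mem_iff_mem _ hu).1 h2
  · intro h
    obtain ⟨t, rfl⟩ := Ideal.mem_span_singleton'.1 h
    rw [map_mul]
    refine Ideal.mul_mem_left _ _ ?_
    have hX : MvPolynomial.X i₀ ∉ (specialPoint α i₀ hα).asHomogeneousIdeal.toIdeal := by
      intro h
      have := mem_specialPoint.1 h 1
      simp [lineEval, hα] at this
    let x : HomogeneousLocalization.NumDenSameDeg (MvPolynomial.homogeneousSubmodule (Fin n) R)
        (specialPoint α i₀ hα).asHomogeneousIdeal.toIdeal.primeCompl :=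
      ⟨1, ⟨_, isHomogeneous_linearForm c⟩, ⟨_, MvPolynomial.isHomogeneous_X R i₀⟩, hX⟩
    have h1 : (HomogeneousLocalization.mk x - structureMap _ 0 : Stalk _) ∈
        stalkIdeal (specialPoint α i₀ hα) (closureIdeal R e C) :=
      mk_sub_structureMap_mem_stalkIdeal (x := x) (by
        rw [MvPolynomial.C_0, zero_mul, sub_zero]
        exact linearForm_mem_closureIdeal hC)
    have h2 : (HomogeneousLocalization.mk x - structureMap _ (∑ i, c i * α i) : Stalk _) ∈
        stalkIdeal (specialPoint α i₀ hα) (closureIdeal R e A) := by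
      refine mk_sub_structureMap_mem_stalkIdeal (x := x) ?_
      change (∑ i, MvPolynomial.C (c i) * MvPolynomial.X i) -
        MvPolynomial.C (∑ i, c i * α i) * MvPolynomial.X i₀ ∈ closureIdeal R e A
      refine mem_closureIdeal_of_isHomogeneous e hA (d := 1)
        ((isHomogeneous_linearForm c).sub ?_) ?_
      · simpa using (MvPolynomial.isHomogeneous_C (Fin n) (∑ i, c i * α i)).mul
          (MvPolynomial.isHomogeneous_X R i₀)
      · simp [hα]
    rw [map_zero, sub_zero] at h1
    have h3 := Ideal.sub_mem _ (Ideal.mem_sup_right (S := stalkIdeal _ (closureIdeal R e A)) h1)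
      (Ideal.mem_sup_left h2)
    rwa [sub_sub_cancel] at h3

/-- A point of `ℙ(M)` that lies on the closures of `ℙ(A)` and of `ℙ(C)` is the special point of the
closure of `ℙ(A)`. -/
theorem eq_specialPoint [IsDomain R] [IsDiscreteValuationRing R] (hα : α i₀ = 1)
    (hA : A = Submodule.span K {∑ i, algebraMap R K (α i) • e i})
    (hC : ∀ v, v ∈ C ↔ ∑ i, algebraMap R K (c i) * e.repr v i = 0)
    (h0 : ∑ i, c i * α i ≠ 0) {P : Point R n}
    (hPA : closureIdeal R e A ≤ P.asHomogeneousIdeal.toIdeal)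
    (hPC : closureIdeal R e C ≤ P.asHomogeneousIdeal.toIdeal) : P = specialPoint α i₀ hα := by
  set I := P.asHomogeneousIdeal.toIdeal with hI
  have hprime : I.IsPrime := P.isPrime
  -- Modulo the ideal of the section, a form of degree `d` is its value at `α` times `X_{i₀}^d`.
  -- Hence `P` is determined by its contraction to `R` once `X_{i₀} ∉ P`.
  have hcongr : ∀ (F : MvPolynomial (Fin n) R) (d : ℕ), F.IsHomogeneous d →
      F - MvPolynomial.C (MvPolynomial.eval α F) * MvPolynomial.X i₀ ^ d ∈ I := by
    intro F d hF
    refine hPA (mem_closureIdeal_of_isHomogeneous e hA (d := d) (hF.sub ?_) ?_)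
    · simpa using (MvPolynomial.isHomogeneous_C (Fin n) (MvPolynomial.eval α F)).mul
        ((MvPolynomial.isHomogeneous_X R i₀).pow d)
    · simp [hα]
  have hX : MvPolynomial.X i₀ ∉ I := by
    intro hX
    refine P.not_irrelevant_le fun F hF => ?_
    change F ∈ I
    rw [HomogeneousIdeal.mem_irrelevant_iff, GradedRing.proj_apply] at hF
    have hF0 : MvPolynomial.homogeneousComponent 0 F = 0 := by
      rw [← hF]
      exact (MvPolynomial.decomposition.decompose'_apply F 0).symm
    rw [← MvPolynomial.sum_homogeneousComponent F]
    refine Ideal.sum_mem _ fun d _ => ?_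
    rcases Nat.eq_zero_or_pos d with rfl | hd
    · rw [hF0]
      exact Ideal.zero_mem _
    · have h1 := hcongr _ d (MvPolynomial.homogeneousComponent_isHomogeneous d F)
      have h2 : MvPolynomial.C (MvPolynomial.eval α (MvPolynomial.homogeneousComponent d F)) *
          MvPolynomial.X i₀ ^ d ∈ I :=
        Ideal.mul_mem_left _ _ (Ideal.pow_mem_of_mem _ hX d hd)
      simpa using Ideal.add_mem _ h1 h2
  have hmem : ∀ (F : MvPolynomial (Fin n) R) (d : ℕ), F.IsHomogeneous d →
      (F ∈ I ↔ MvPolynomial.C (MvPolynomial.eval α F) ∈ I) := by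
    intro F d hF
    rw [← sub_add_cancel F (MvPolynomial.C (MvPolynomial.eval α F) * MvPolynomial.X i₀ ^ d),
      Ideal.add_mem_iff_right _ (hcongr F d hF), sub_add_cancel]
    exact ⟨fun h => (hprime.mem_or_mem h).resolve_right fun h => hX (hprime.mem_of_pow_mem _ h),
      fun h => Ideal.mul_mem_right _ _ h⟩
  have hcomap : I.comap MvPolynomial.C = IsLocalRing.maximalIdeal R := by
    have h1 : (I.comap (MvPolynomial.C : R →+* MvPolynomial (Fin n) R)).IsPrime :=
      Ideal.comap_isPrime _ _
    refine IsLocalRing.eq_maximalIdeal (h1.isMaximal ?_)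
    -- The contraction contains `c(α) ≠ 0`, so it is a nonzero prime of a discrete valuation ring.
    intro hbot
    have h2 := (hmem _ 1 (isHomogeneous_linearForm c)).1 (hPC (linearForm_mem_closureIdeal hC))
    rw [← Ideal.mem_comap, hbot] at h2
    exact h0 (by simpa using h2)
  refine ProjectiveSpectrum.ext (HomogeneousIdeal.toIdeal_injective (Ideal.ext fun F => ?_))
  rw [← hI, mem_specialPoint, ← hcomap]
  simp only [lineEval_coeff, Ideal.mem_comap]
  have h3 : F ∈ I ↔ ∀ d, MvPolynomial.homogeneousComponent d F ∈ I := by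
    refine ⟨fun h d => ?_, fun h => ?_⟩
    · have := P.asHomogeneousIdeal.isHomogeneous d h
      rwa [show ((DirectSum.decompose (MvPolynomial.homogeneousSubmodule (Fin n) R) F d :
        MvPolynomial (Fin n) R)) = MvPolynomial.homogeneousComponent d F from
        MvPolynomial.decomposition.decompose'_apply F d] at this
    · rw [← MvPolynomial.sum_homogeneousComponent F]
      exact Ideal.sum_mem _ fun d _ => h d
  rw [h3]
  exact forall_congr' fun d => hmem _ d (MvPolynomial.homogeneousComponent_isHomogeneous d F)

/-- The intersection number of the closures of the point with primitive coordinates `α` and of the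
hyperplane of a primitive linear form `c` is the order of `c(α)`. -/
theorem intersectionNumber_eq [IsDomain R] [IsDiscreteValuationRing R] [Infinite K]
    [IsFractionRing R K] (hα : α i₀ = 1) (hc : c j₀ = 1)
    (hA : A = Submodule.span K {∑ i, algebraMap R K (α i) • e i})
    (hC : ∀ v, v ∈ C ↔ ∑ i, algebraMap R K (c i) * e.repr v i = 0)
    (h0 : ∑ i, c i * α i ≠ 0) :
    intersectionNumber R e A C = (Ring.ord R (∑ i, c i * α i)).toNat := by
  set P₀ : Point R n := specialPoint α i₀ hα
  set J := stalkIdeal P₀ (closureIdeal R e A) ⊔ stalkIdeal P₀ (closureIdeal R e C)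
  have hsurj : ∀ x : Stalk P₀, ∃ r : R, x - structureMap P₀ r ∈ J := fun x =>
    (exists_sub_structureMap_mem_stalkIdeal hα hA x).imp fun r hr => Ideal.mem_sup_left hr
  rw [intersectionNumber, finsum_eq_single _ P₀]
  · rw [length_quotient_eq_of_structureMap hsurj
      (structureMap_mem_stalkIdeal_sup_iff hα hc hA hC)]
    change (Ring.ord R _).toNat * _ = _
    -- If the closures are disjoint at `P₀`, the length is zero and the residue degree does not
    -- matter.
    by_cases hJ : J = ⊤
    · have h1 : IsUnit (∑ i, c i * α i) := by
        rw [← Ideal.span_singleton_eq_top, Ideal.eq_top_iff_one,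
          ← structureMap_mem_stalkIdeal_sup_iff hα hc hA hC]
        change _ ∈ J
        rw [hJ]
        trivial
      rw [Ring.ord_of_isUnit h1, ENat.toNat_zero, zero_mul]
    · rw [residueDegree_eq_one hJ hsurj, mul_one]
  · intro P hP
    have : stalkIdeal P (closureIdeal R e A) ⊔ stalkIdeal P (closureIdeal R e C) = ⊤ := by
      by_contra htop
      refine hP (eq_specialPoint hα hA hC h0 (le_of_stalkIdeal_ne_top fun h => htop ?_)
        (le_of_stalkIdeal_ne_top fun h => htop ?_))
      · rw [h, top_sup_eq]
      · rw [h, sup_top_eq]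
    rw [this, Module.length_eq_zero_iff.2 (Ideal.Quotient.subsingleton_iff.2 rfl)]
    simp

end IntersectionNumber

end ProjectiveModel

namespace BruhatTits

/-! ### Orders of elements of `K` -/

section Order

variable {R K : Type*} [CommRing R] [Field K] [Algebra R K]

variable (K) in
/-- The fractional ideal `ϖ^p R`. -/
def powIdeal (ϖ : R) (p : ℤ) : Submodule R K :=
  Submodule.span R {algebraMap R K ϖ ^ p}

/-- `x ∈ K` has order `k`, i.e. `x` is a unit times `ϖ^k`. -/
def HasOrder (ϖ : R) (x : K) (k : ℤ) : Prop :=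
  ∃ u : Rˣ, x = algebraMap R K u * algebraMap R K ϖ ^ k

theorem mem_powIdeal {ϖ : R} {p : ℤ} {x : K} :
    x ∈ powIdeal K ϖ p ↔ ∃ a : R, algebraMap R K a * algebraMap R K ϖ ^ p = x := by
  simp [powIdeal, Submodule.mem_span_singleton, Algebra.smul_def]

theorem mem_powIdeal_zero {ϖ : R} {x : K} :
    x ∈ powIdeal K ϖ 0 ↔ ∃ a : R, algebraMap R K a = x := by
  simp [mem_powIdeal]

theorem hasOrder_zpow (ϖ : R) (k : ℤ) : HasOrder ϖ (algebraMap R K ϖ ^ k) k := ⟨1, by simp⟩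

theorem HasOrder.inv {ϖ : R} {x : K} {k : ℤ} (hx : HasOrder ϖ x k) : HasOrder ϖ x⁻¹ (-k) := by
  obtain ⟨u, rfl⟩ := hx
  refine ⟨u⁻¹, ?_⟩
  rw [mul_inv, ← zpow_neg]
  congr 1
  refine inv_eq_of_mul_eq_one_right ?_
  rw [← map_mul, Units.mul_inv, map_one]

variable [IsFractionRing R K] {ϖ : R}

theorem HasOrder.mul (hϖ : Irreducible ϖ) {x y : K} {k l : ℤ} (hx : HasOrder ϖ x k)
    (hy : HasOrder ϖ y l) : HasOrder ϖ (x * y) (k + l) := by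
  obtain ⟨u, rfl⟩ := hx
  obtain ⟨v, rfl⟩ := hy
  refine ⟨u * v, ?_⟩
  rw [zpow_add₀ (by simpa using hϖ.ne_zero), Units.val_mul, map_mul]
  ring

theorem HasOrder.div (hϖ : Irreducible ϖ) {x y : K} {k l : ℤ} (hx : HasOrder ϖ x k)
    (hy : HasOrder ϖ y l) : HasOrder ϖ (x / y) (k - l) := by
  rw [div_eq_mul_inv, sub_eq_add_neg]
  exact hx.mul hϖ hy.inv

theorem HasOrder.mul_mem_powIdeal (hϖ : Irreducible ϖ) {x y : K} {k p q : ℤ}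
    (hx : HasOrder ϖ x k) (hy : y ∈ powIdeal K ϖ p) (hq : k + p = q) :
    x * y ∈ powIdeal K ϖ q := by
  obtain ⟨u, rfl⟩ := hx
  obtain ⟨a, rfl⟩ := mem_powIdeal.1 hy
  refine mem_powIdeal.2 ⟨u * a, ?_⟩
  rw [← hq, zpow_add₀ (by simpa using hϖ.ne_zero), map_mul]
  ring

theorem HasOrder.mem_powIdeal_iff (hϖ : Irreducible ϖ) {x : K} {k p : ℤ} (hx : HasOrder ϖ x k) :
    x ∈ powIdeal K ϖ p ↔ p ≤ k := by
  constructor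
  · intro h
    by_contra! hlt
    -- The exponent `-k - 1` turns `x` into `u/ϖ`; integrality of this would make `ϖ` divide the
    -- unit `u`.
    have h1 := (hasOrder_zpow (K := K) ϖ (-k - 1)).mul_mem_powIdeal hϖ h (q := p - k - 1) (by ring)
    obtain ⟨m, hm⟩ : ∃ m : ℕ, p - k - 1 = m := ⟨(p - k - 1).toNat, by omega⟩
    obtain ⟨a, ha⟩ := mem_powIdeal.1 h1
    obtain ⟨u, rfl⟩ := hx
    have h0 : algebraMap R K ϖ ≠ 0 := by simpa using hϖ.ne_zero
    have h2 : algebraMap R K (a * ϖ ^ m * ϖ) = algebraMap R K u := by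
      rw [hm, zpow_natCast, mul_left_comm, ← zpow_add₀ h0, show -k - 1 + k = -1 by ring,
        zpow_neg_one] at ha
      rw [map_mul, map_mul, map_pow, ha, inv_mul_cancel_right₀ h0]
    have h3 := IsFractionRing.injective R K h2
    exact hϖ.not_isUnit (isUnit_of_dvd_unit (Dvd.intro_left _ h3) u.isUnit)
  · intro h
    obtain ⟨u, rfl⟩ := hx
    obtain ⟨m, hm⟩ : ∃ m : ℕ, k = m + p := ⟨(k - p).toNat, by omega⟩
    refine mem_powIdeal.2 ⟨u * ϖ ^ m, ?_⟩
    rw [hm, zpow_add₀ (by simpa using hϖ.ne_zero), map_mul, map_pow, zpow_natCast, mul_assoc]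

theorem powIdeal_mono (hϖ : Irreducible ϖ) {p q : ℤ} (h : p ≤ q) :
    powIdeal K ϖ q ≤ powIdeal K ϖ p := by
  rw [powIdeal, Submodule.span_singleton_le_iff_mem, (hasOrder_zpow ϖ q).mem_powIdeal_iff hϖ]
  exact h

theorem HasOrder.unique (hϖ : Irreducible ϖ) {x : K} {k l : ℤ} (hk : HasOrder ϖ x k)
    (hl : HasOrder ϖ x l) : k = l :=
  le_antisymm ((hl.mem_powIdeal_iff hϖ).1 ((hk.mem_powIdeal_iff hϖ).2 le_rfl))
    ((hk.mem_powIdeal_iff hϖ).1 ((hl.mem_powIdeal_iff hϖ).2 le_rfl))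

theorem HasOrder.ne_zero [IsDomain R] (hϖ : Irreducible ϖ) {x : K} {k : ℤ} (h : HasOrder ϖ x k) : x ≠ 0 := by
  obtain ⟨u, rfl⟩ := h
  exact mul_ne_zero (by simp) (algebraMap_zpow_ne_zero hϖ k)

variable [IsDomain R] [IsDiscreteValuationRing R]

theorem exists_hasOrder (hϖ : Irreducible ϖ) {x : K} (hx : x ≠ 0) : ∃ k, HasOrder ϖ x k := by
  obtain ⟨k, u, h⟩ := IsDiscreteValuationRing.exists_units_eq_smul_zpow_of_irreducible hϖ hx
  exact ⟨k, u, by rw [h, Units.smul_def, Algebra.smul_def]⟩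

theorem HasOrder.toNat_ord (hϖ : Irreducible ϖ) {r : R} {k : ℤ}
    (h : HasOrder ϖ (algebraMap R K r) k) : ((Ring.ord R r).toNat : ℤ) = k := by
  have hr : r ≠ 0 := by
    rintro rfl
    exact h.ne_zero hϖ (map_zero _)
  obtain ⟨m, u, rfl⟩ := IsDiscreteValuationRing.eq_unit_mul_pow_irreducible hr hϖ
  have h1 : HasOrder ϖ (algebraMap R K (u * ϖ ^ m)) m := ⟨u, by simp⟩
  rw [h.unique hϖ h1, Ring.ord_mul_of_isUnit_left u.isUnit,
    Ring.ord_pow (mem_nonZeroDivisors_of_ne_zero hϖ.ne_zero), Ring.ord_of_irreducible hϖ]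
  simp

end Order

/-! ### Lattice classes and walks in the building -/

section Vertices

variable {R K V : Type*} [CommRing R] [Field K] [Algebra R K] [AddCommGroup V]
  [Module K V] [Module R V] [IsScalarTower R K V]

theorem vertex_eq_iff {L L' : Submodule R V} {hL : IsLatticeIn L (⊤ : Submodule K V)}
    {hL' : IsLatticeIn L' (⊤ : Submodule K V)} :
    vertex L hL = vertex L' hL' ↔ ∃ c : K, c ≠ 0 ∧ L' = c • L :=
  Quotient.eq

theorem vertex_congr {L L' : Submodule R V} {hL : IsLatticeIn L (⊤ : Submodule K V)}
    {hL' : IsLatticeIn L' (⊤ : Submodule K V)} (h : L = L') : vertex L hL = vertex L' hL' := by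
  subst h
  rfl

theorem mem_smul_iff {L : Submodule R V} {c : K} (hc : c ≠ 0) {v : V} :
    v ∈ c • L ↔ c⁻¹ • v ∈ L := by
  rw [Submodule.mem_smul_pointwise_iff_exists]
  constructor
  · rintro ⟨b, hb, rfl⟩
    rwa [inv_smul_smul₀ hc]
  · intro h
    exact ⟨_, h, smul_inv_smul₀ hc v⟩

/-- The symmetrized edge relation can be oriented upwards from any given representative: if the
neighbour is given by a smaller lattice, dividing that lattice by `ϖ` makes it larger. -/
theorem exists_lattice_of_adj [IsLocalRing R] {ϖ : R}
    (hϖ : IsLocalRing.maximalIdeal R = Ideal.span {ϖ}) (h0 : algebraMap R K ϖ ≠ 0)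
    {x y : Vertex R K V} (hxy : (skeleton R K V).Adj x y) {L : Submodule R V}
    {hL : IsLatticeIn L (⊤ : Submodule K V)} (hx : x = vertex L hL) :
    ∃ (L' : Submodule R V) (hL' : IsLatticeIn L' (⊤ : Submodule K V)), y = vertex L' hL' ∧
      L ≤ L' ∧ ∀ v ∈ L', algebraMap R K ϖ • v ∈ L := by
  have hmem : ϖ ∈ IsLocalRing.maximalIdeal R := hϖ ▸ Ideal.mem_span_singleton_self ϖ
  subst hx
  rw [skeleton, SimpleGraph.fromRel_adj] at hxy
  obtain ⟨-, ⟨L₀, L₁, hL₀, hL₁, h₀, h₁, h, h'⟩ | ⟨L₁, L₀, hL₁, hL₀, h₁, h₀, h, h'⟩⟩ := hxy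
  · obtain ⟨c, hc, rfl⟩ := vertex_eq_iff.1 h₀
    refine ⟨c • L₁, hL₁.smul hc, ?_, fun v hv => ?_, fun v hv => ?_⟩
    · rw [← h₁]
      exact vertex_eq_iff.2 ⟨c, hc, rfl⟩
    · rw [mem_smul_iff hc] at hv ⊢
      exact h' hv
    · rw [mem_smul_iff hc] at hv ⊢
      rw [smul_comm, algebraMap_smul]
      exact h (Submodule.smul_mem_smul hmem hv)
  · obtain ⟨c, hc, rfl⟩ := vertex_eq_iff.1 h₀
    have hc' : c * (algebraMap R K ϖ)⁻¹ ≠ 0 := mul_ne_zero hc (inv_ne_zero h0)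
    refine ⟨(c * (algebraMap R K ϖ)⁻¹) • L₁, hL₁.smul hc', ?_, fun v hv => ?_, fun v hv => ?_⟩
    · rw [← h₁]
      exact vertex_eq_iff.2 ⟨_, hc', rfl⟩
    · rw [mem_smul_iff hc] at hv
      rw [mem_smul_iff hc', mul_inv_rev, inv_inv, mul_smul, algebraMap_smul]
      exact h (Submodule.smul_mem_smul hmem hv)
    · rw [mem_smul_iff hc', mul_inv_rev, inv_inv, mul_smul, smul_comm] at hv
      rw [mem_smul_iff hc]
      exact h' hv

/-- Chaining the upward steps bounds the relative position of the end lattices by the length of the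
walk; this yields the lower bound for distances. -/
theorem exists_lattice_of_walk [IsLocalRing R] {ϖ : R}
    (hϖ : IsLocalRing.maximalIdeal R = Ideal.span {ϖ}) (h0 : algebraMap R K ϖ ≠ 0)
    {x y : Vertex R K V} (p : (skeleton R K V).Walk x y) {L : Submodule R V}
    {hL : IsLatticeIn L (⊤ : Submodule K V)} (hx : x = vertex L hL) :
    ∃ (L' : Submodule R V) (hL' : IsLatticeIn L' (⊤ : Submodule K V)), y = vertex L' hL' ∧
      L ≤ L' ∧ ∀ v ∈ L', algebraMap R K ϖ ^ p.length • v ∈ L := by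
  induction p generalizing L with
  | nil => exact ⟨L, hL, hx, le_rfl, by simp⟩
  | cons hadj p ih =>
    obtain ⟨L₁, hL₁, h₁, hle, hsmul⟩ := exists_lattice_of_adj hϖ h0 hadj hx
    obtain ⟨L', hL', h', hle', hsmul'⟩ := ih h₁
    refine ⟨L', hL', h', hle.trans hle', fun v hv => ?_⟩
    rw [SimpleGraph.Walk.length_cons, pow_succ', mul_smul]
    exact hsmul _ (hsmul' v hv)

theorem mem_span_zpow_smul_iff {ϖ : R} {ι : Type*} [Finite ι] (w : Module.Basis ι K V) (k : ι → ℤ)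
    {v : V} : v ∈ Submodule.span R (Set.range fun i => algebraMap R K ϖ ^ k i • w i) ↔
      ∀ i, w.repr v i ∈ powIdeal K ϖ (k i) := by
  have := Fintype.ofFinite ι
  rw [Submodule.mem_span_range_iff_exists_fun]
  constructor
  · rintro ⟨c, rfl⟩ i
    refine mem_powIdeal.2 ⟨c i, ?_⟩
    simp_rw [← algebraMap_smul K (c _), smul_smul]
    rw [w.repr_sum_self]
  · intro h
    choose c hc using fun i => mem_powIdeal.1 (h i)
    refine ⟨c, ?_⟩
    conv_rhs => rw [← w.sum_repr v]
    simp_rw [← algebraMap_smul K (c _), smul_smul, hc]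

end Vertices

/-! ### Half-geodesics in terms of lattices -/

section Apartment

variable {R K V : Type*} [CommRing R] [IsDomain R] [Field K]
  [Algebra R K] [IsFractionRing R K] [AddCommGroup V] [Module K V] [Module R V]
  [IsScalarTower R K V] {ϖ : R}

open Classical in
/-- A description of half-geodesics without apartments: the `m`-th vertex of `[{L}, y_W]` is the
class of `L + π^{-m} (L ∩ W)`. -/
theorem exists_eq_of_mem_halfGeodesic (hϖ : Irreducible ϖ) {L : Submodule R V}
    {hL : IsLatticeIn L (⊤ : Submodule K V)} {W : Submodule K V} {y : Vertex R K V}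
    (hy : y ∈ halfGeodesic hϖ (vertex L hL) W) :
    ∃ (m : ℕ) (h : IsLatticeIn (L ⊔ algebraMap R K ϖ ^ (-m : ℤ) • (L ⊓ W.restrictScalars R))
      (⊤ : Submodule K V)), y = vertex _ h := by
  obtain ⟨w, s, k, m, hs, hx, rfl⟩ := hy
  obtain ⟨c, hc, hcL⟩ := vertex_eq_iff.1 hx.symm
  have hm : algebraMap R K ϖ ^ (-m : ℤ) ≠ 0 := algebraMap_zpow_ne_zero hϖ _
  set L₀ := Submodule.span R (Set.range fun i => algebraMap R K ϖ ^ k i • w i) with hL₀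
  set L₁ := Submodule.span R (Set.range fun i =>
    algebraMap R K ϖ ^ (if i ∈ s then k i - m else k i) • w i) with hL₁
  have hW : ∀ {v}, v ∈ W ↔ ∀ i, i ∉ s → w.repr v i = 0 := by
    intro v
    rw [← hs, w.mem_span_image]
    simp only [Set.subset_def, Finset.mem_coe, Finsupp.mem_support_iff]
    exact forall_congr' fun i => not_imp_comm
  have key : L₁ = L₀ ⊔ algebraMap R K ϖ ^ (-m : ℤ) • (L₀ ⊓ W.restrictScalars R) := by
    apply le_antisymm
    · rw [hL₁, Submodule.span_le]
      rintro _ ⟨i, rfl⟩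
      dsimp only
      split_ifs with hi
      · refine Submodule.mem_sup_right ((mem_smul_iff hm).2 ?_)
        have h1 : (algebraMap R K ϖ ^ (-m : ℤ))⁻¹ • algebraMap R K ϖ ^ (k i - m) • w i =
            algebraMap R K ϖ ^ k i • w i := by
          rw [smul_smul, ← zpow_neg, ← zpow_add₀ (by simpa using hϖ.ne_zero)]
          congr 2
          ring
        rw [h1]
        refine ⟨Submodule.subset_span ⟨i, rfl⟩, W.smul_mem _ ?_⟩
        rw [← hs]
        exact Submodule.subset_span ⟨i, hi, rfl⟩
      · exact Submodule.mem_sup_left (Submodule.subset_span ⟨i, rfl⟩)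
    · refine sup_le (fun v hv => ?_) (fun v hv => ?_)
      · rw [hL₀, mem_span_zpow_smul_iff] at hv
        rw [hL₁, mem_span_zpow_smul_iff]
        refine fun i => powIdeal_mono hϖ ?_ (hv i)
        split_ifs <;> omega
      · rw [mem_smul_iff hm] at hv
        obtain ⟨hv₀, hvW⟩ := hv
        rw [SetLike.mem_coe, hL₀, mem_span_zpow_smul_iff] at hv₀
        rw [hL₁, mem_span_zpow_smul_iff]
        intro i
        split_ifs with hi
        · have h2 := (hasOrder_zpow (K := K) ϖ (-m : ℤ)).mul_mem_powIdeal hϖ (hv₀ i)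
            (q := k i - m) (by ring)
          rwa [map_smul, Finsupp.smul_apply, smul_eq_mul, mul_inv_cancel_left₀ hm] at h2
        · have h2 := hW.1 hvW i hi
          rw [map_smul, Finsupp.smul_apply, smul_eq_mul] at h2
          rw [(mul_eq_zero.1 h2).resolve_left (inv_ne_zero hm)]
          exact Submodule.zero_mem _
  have hcL₁ : L ⊔ algebraMap R K ϖ ^ (-m : ℤ) • (L ⊓ W.restrictScalars R) = c • L₁ := by
    -- `W` is stable under `K^×`, so the description does not depend on the representative of the
    -- class.
    have h4 : c • (L₀ ⊓ W.restrictScalars R) = L ⊓ W.restrictScalars R := by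
      ext v
      rw [hcL, mem_smul_iff hc, Submodule.mem_inf, Submodule.mem_inf, mem_smul_iff hc,
        Submodule.restrictScalars_mem, Submodule.restrictScalars_mem,
        W.smul_mem_iff (inv_ne_zero hc)]
    rw [key, Submodule.smul_sup', ← hcL, smul_comm, h4]
  have hL₁top : IsLatticeIn L₁ (⊤ : Submodule K V) :=
    isLatticeIn_span _ _ (span_range_smul_eq_top w fun i => algebraMap_zpow_ne_zero hϖ _)
  exact ⟨m, hcL₁ ▸ hL₁top.smul hc, vertex_eq_iff.2 ⟨_, hc, hcL₁⟩⟩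

end Apartment

end BruhatTits

namespace BruhatTits

/-! ### Frames adapted to the geodesic -/

section Frame

variable {R K V : Type*} [CommRing R] [Field K] [AddCommGroup V] [Module K V] [Module R V]

/-- `V` is the direct sum of the span of the lattice `N` and of the lines of the vectors `x₁`, `x₂`,
and `f₁`, `f₂` are the coordinate functionals that belong to `x₁`, `x₂`. -/
structure IsFrame (N : Submodule R V) (x₁ x₂ : V) (f₁ f₂ : V →ₗ[K] K) : Prop where
  fg : N.FG
  span_eq : Submodule.span K (N : Set V) = LinearMap.ker f₁ ⊓ LinearMap.ker f₂
  f₁_x₁ : f₁ x₁ = 1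
  f₁_x₂ : f₁ x₂ = 0
  f₂_x₁ : f₂ x₁ = 0
  f₂_x₂ : f₂ x₂ = 1

variable {N : Submodule R V} {x₁ x₂ : V} {f₁ f₂ : V →ₗ[K] K}

theorem IsFrame.map_f₁ (h : IsFrame N x₁ x₂ f₁ f₂) {v : V} (hv : v ∈ N) : f₁ v = 0 :=
  (h.span_eq ▸ Submodule.subset_span hv : v ∈ LinearMap.ker f₁ ⊓ LinearMap.ker f₂).1

theorem IsFrame.map_f₂ (h : IsFrame N x₁ x₂ f₁ f₂) {v : V} (hv : v ∈ N) : f₂ v = 0 :=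
  (h.span_eq ▸ Submodule.subset_span hv : v ∈ LinearMap.ker f₁ ⊓ LinearMap.ker f₂).2

theorem IsFrame.span_triple (h : IsFrame N x₁ x₂ f₁ f₂) :
    Submodule.span K (N : Set V) ⊔ Submodule.span K {x₁} ⊔ Submodule.span K {x₂} = ⊤ := by
  rw [eq_top_iff]
  intro v _
  have h1 : v - f₁ v • x₁ - f₂ v • x₂ ∈ Submodule.span K (N : Set V) := by
    rw [h.span_eq]
    constructor <;> simp [h.f₁_x₁, h.f₁_x₂, h.f₂_x₁, h.f₂_x₂]
  have h2 : v = (v - f₁ v • x₁ - f₂ v • x₂) + f₁ v • x₁ + f₂ v • x₂ := by abel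
  rw [h2]
  exact Submodule.add_mem_sup (Submodule.add_mem_sup h1 (Submodule.smul_mem _ _
    (Submodule.mem_span_singleton_self _)))
    (Submodule.smul_mem _ _ (Submodule.mem_span_singleton_self _))

theorem IsFrame.eq_zero (h : IsFrame N x₁ x₂ f₁ f₂) {a b : K} (hab : a • x₁ + b • x₂ = 0) :
    a = 0 ∧ b = 0 := by
  constructor
  · simpa [h.f₁_x₁, h.f₁_x₂] using congrArg f₁ hab
  · simpa [h.f₂_x₁, h.f₂_x₂] using congrArg f₂ hab

theorem IsFrame.swap (h : IsFrame N x₁ x₂ f₁ f₂) : IsFrame N x₂ x₁ f₂ f₁ :=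
  ⟨h.fg, h.span_eq.trans (inf_comm _ _), h.f₂_x₂, h.f₂_x₁, h.f₁_x₂, h.f₁_x₁⟩

/-- Together with `IsFrame.add_smul_right`, this makes the line of `x₁ + u • x₂` an axis of a frame,
in place of either old axis. The functionals change so as to stay dual to the new vectors. -/
theorem IsFrame.add_smul_left (h : IsFrame N x₁ x₂ f₁ f₂) (u : K) :
    IsFrame N (x₁ + u • x₂) x₂ f₁ (f₂ - u • f₁) := by
  refine ⟨h.fg, ?_, ?_, ?_, ?_, ?_⟩
  · rw [h.span_eq]
    ext v
    simp only [Submodule.mem_inf, LinearMap.mem_ker, LinearMap.sub_apply, LinearMap.smul_apply]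
    exact and_congr_right fun h1 => by simp [h1]
  all_goals simp [h.f₁_x₁, h.f₁_x₂, h.f₂_x₁, h.f₂_x₂]

theorem IsFrame.add_smul_right (h : IsFrame N x₁ x₂ f₁ f₂) {u : K} (hu : u ≠ 0) :
    IsFrame N x₁ (x₁ + u • x₂) (f₁ - u⁻¹ • f₂) (u⁻¹ • f₂) := by
  refine ⟨h.fg, ?_, ?_, ?_, ?_, ?_⟩
  · rw [h.span_eq]
    ext v
    simp only [Submodule.mem_inf, LinearMap.mem_ker, LinearMap.sub_apply, LinearMap.smul_apply,
      smul_eq_mul, mul_eq_zero, inv_eq_zero, hu, false_or]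
    exact and_congr_left fun h1 => by simp [h1]
  all_goals simp [h.f₁_x₁, h.f₁_x₂, h.f₂_x₁, h.f₂_x₂, hu]

variable [Algebra R K]

variable (K) in
/-- The lattice `N + ϖ^p R x₁ + ϖ^q R x₂`. -/
def frameLattice (ϖ : R) (N : Submodule R V) (x₁ x₂ : V) (p q : ℤ) : Submodule R V :=
  N ⊔ Submodule.span R {algebraMap R K ϖ ^ p • x₁} ⊔ Submodule.span R {algebraMap R K ϖ ^ q • x₂}

theorem frameLattice_swap (ϖ : R) (p q : ℤ) :
    frameLattice K ϖ N x₂ x₁ q p = frameLattice K ϖ N x₁ x₂ p q := by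
  rw [frameLattice, frameLattice, sup_right_comm]

variable [IsScalarTower R K V] {ϖ : R}

theorem IsFrame.mem_frameLattice (h : IsFrame N x₁ x₂ f₁ f₂) {p q : ℤ} {v : V} :
    v ∈ frameLattice K ϖ N x₁ x₂ p q ↔
      f₁ v ∈ powIdeal K ϖ p ∧ f₂ v ∈ powIdeal K ϖ q ∧ v - f₁ v • x₁ - f₂ v • x₂ ∈ N := by
  rw [frameLattice, Submodule.mem_sup]
  constructor
  · rintro ⟨_, hyy, z, hz, rfl⟩
    obtain ⟨y, hy, y', hy', rfl⟩ := Submodule.mem_sup.1 hyy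
    obtain ⟨a, rfl⟩ := Submodule.mem_span_singleton.1 hy'
    obtain ⟨b, rfl⟩ := Submodule.mem_span_singleton.1 hz
    rw [← algebraMap_smul K a, ← algebraMap_smul K b, smul_smul, smul_smul]
    simp only [map_add, map_smul, h.map_f₁ hy, h.map_f₂ hy, h.f₁_x₁, h.f₁_x₂, h.f₂_x₁, h.f₂_x₂,
      smul_eq_mul, mul_one, mul_zero, zero_add, add_zero]
    refine ⟨mem_powIdeal.2 ⟨a, rfl⟩, mem_powIdeal.2 ⟨b, rfl⟩, ?_⟩
    convert hy using 1
    abel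
  · rintro ⟨h1, h2, h3⟩
    obtain ⟨a, ha⟩ := mem_powIdeal.1 h1
    obtain ⟨b, hb⟩ := mem_powIdeal.1 h2
    refine ⟨_, Submodule.add_mem_sup h3 (Submodule.mem_span_singleton.2 ⟨a, rfl⟩), _,
      Submodule.mem_span_singleton.2 ⟨b, rfl⟩, ?_⟩
    rw [← algebraMap_smul K a, ← algebraMap_smul K b, smul_smul, smul_smul, ha, hb]
    abel

theorem IsFrame.frameLattice_add_smul_left [IsFractionRing R K] (hϖ : Irreducible ϖ) (h : IsFrame N x₁ x₂ f₁ f₂)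
    {u : K} {k q : ℤ} (hu : HasOrder ϖ u k) (hq : q ≤ k) :
    frameLattice K ϖ N (x₁ + u • x₂) x₂ 0 q = frameLattice K ϖ N x₁ x₂ 0 q := by
  ext v
  rw [(h.add_smul_left u).mem_frameLattice, h.mem_frameLattice]
  refine and_congr_right fun h1 => and_congr ?_ ?_
  · have h2 := hu.mul_mem_powIdeal hϖ h1 (add_zero k)
    exact Submodule.sub_mem_iff_left _ (powIdeal_mono hϖ hq h2)
  · rw [iff_iff_eq]
    congr 1
    simp only [LinearMap.sub_apply, LinearMap.smul_apply, smul_eq_mul]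
    module

variable [IsDomain R] [IsFractionRing R K]

/-- A finitely generated `R`-submodule of `V` is spanned by vectors that are linearly independent
over `K`. -/
theorem exists_linearIndependent_span_eq [IsPrincipalIdealRing R] (hN : N.FG) :
    ∃ (m : ℕ) (v : Fin m → V), LinearIndependent K v ∧ Submodule.span R (Set.range v) = N := by
  have htf : Module.IsTorsionFree R V := Module.IsTorsionFree.trans_faithfulSMul R K V
  have hfin : Module.Finite R N := Module.Finite.iff_fg.2 hN
  let b := Module.finBasis R N
  refine ⟨_, fun i => (b i : V), (LinearIndependent.iff_fractionRing R K).1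
    (b.linearIndependent.map' N.subtype N.ker_subtype), ?_⟩
  have h1 := congrArg (Submodule.map N.subtype) b.span_eq
  rwa [Submodule.map_span, ← Set.range_comp, Submodule.map_top, Submodule.range_subtype] at h1

/-- A lattice in a line is generated by one vector. -/
theorem IsLatticeIn.exists_eq_span_singleton [IsPrincipalIdealRing R] {x : V} (hx : x ≠ 0)
    (h : IsLatticeIn N (Submodule.span K {x})) :
    ∃ y, y ≠ 0 ∧ N = Submodule.span R {y} ∧ Submodule.span K {y} = Submodule.span K {x} := by
  obtain ⟨m, v, hv, hN⟩ := exists_linearIndependent_span_eq (K := K) h.1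
  have hvK : Submodule.span K (Set.range v) = Submodule.span K {x} := by
    rw [← h.2, ← hN]
    exact (Submodule.span_span_of_tower R K (Set.range v)).symm
  have h1 := finrank_span_eq_card hv
  rw [hvK, finrank_span_singleton hx, Fintype.card_fin] at h1
  subst h1
  have hr : Set.range v = {v 0} := by
    rw [Set.range_unique]
    rfl
  rw [hr] at hN hvK
  exact ⟨v 0, hv.ne_zero 0, hN.symm, hvK⟩

/-- A frame belongs to an apartment. -/
theorem IsFrame.exists_basis [IsPrincipalIdealRing R] (h : IsFrame N x₁ x₂ f₁ f₂) :
    ∃ (w : Module.Basis (Fin (Module.finrank K V)) K V) (i₁ i₂ : Fin (Module.finrank K V)),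
      i₁ ≠ i₂ ∧ w i₁ = x₁ ∧ w i₂ = x₂ ∧ ∀ p q : ℤ,
        Submodule.span R (Set.range fun i => algebraMap R K ϖ ^
          (if i = i₁ then p else if i = i₂ then q else 0) • w i) =
          frameLattice K ϖ N x₁ x₂ p q := by
  obtain ⟨l, v, hli, hvN⟩ := exists_linearIndependent_span_eq (K := K) h.fg
  have hvK : Submodule.span K (Set.range v) = LinearMap.ker f₁ ⊓ LinearMap.ker f₂ := by
    rw [← h.span_eq, ← hvN]
    exact (Submodule.span_span_of_tower R K (Set.range v)).symm
  have hli' : LinearIndependent K ![x₁, x₂] := LinearIndependent.pair_iff.2 fun _ _ => h.eq_zero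
  have hdisj : Disjoint (Submodule.span K (Set.range v))
      (Submodule.span K (Set.range ![x₁, x₂])) := by
    rw [Submodule.disjoint_def, hvK]
    intro z hz hz'
    rw [Matrix.range_cons_cons_empty, Submodule.mem_span_pair] at hz'
    obtain ⟨s, t, rfl⟩ := hz'
    have h1 : f₁ (s • x₁ + t • x₂) = 0 := hz.1
    have h2 : f₂ (s • x₁ + t • x₂) = 0 := hz.2
    simp only [map_add, map_smul, h.f₁_x₁, h.f₁_x₂, h.f₂_x₁, h.f₂_x₂, smul_eq_mul, mul_one,
      mul_zero, zero_add, add_zero] at h1 h2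
    simp [h1, h2]
  let w₀ : Module.Basis (Fin l ⊕ Fin 2) K V := Module.Basis.mk (hli.sum_type hli' hdisj) (by
    rw [Set.Sum.elim_range, Submodule.span_union, hvK, ← h.span_eq, Matrix.range_cons_cons_empty,
      Submodule.span_insert, ← sup_assoc, h.span_triple])
  have hcard : Fintype.card (Fin l ⊕ Fin 2) = Module.finrank K V :=
    (Module.finrank_eq_card_basis w₀).symm
  let σ : Fin l ⊕ Fin 2 ≃ Fin (Module.finrank K V) := Fintype.equivFinOfCardEq hcard
  refine ⟨w₀.reindex σ, σ (Sum.inr 0), σ (Sum.inr 1), by simp, by simp [w₀], by simp [w₀],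
    fun p q => ?_⟩
  rw [← σ.surjective.range_comp]
  have h3 : ((fun i => algebraMap R K ϖ ^ (if i = σ (Sum.inr 0) then p
      else if i = σ (Sum.inr 1) then q else 0) • w₀.reindex σ i) ∘ σ) =
      Sum.elim v ![algebraMap R K ϖ ^ p • x₁, algebraMap R K ϖ ^ q • x₂] := by
    funext i
    rcases i with i | i
    · simp [w₀]
    · fin_cases i <;> simp [w₀]
  rw [h3, Set.Sum.elim_range, Submodule.span_union, hvN, Matrix.range_cons_cons_empty,
    Submodule.span_insert, ← sup_assoc, frameLattice]

theorem IsFrame.isLatticeIn_frameLattice (hϖ : Irreducible ϖ) (h : IsFrame N x₁ x₂ f₁ f₂)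
    (p q : ℤ) : IsLatticeIn (frameLattice K ϖ N x₁ x₂ p q) (⊤ : Submodule K V) := by
  have h1 : ∀ (x : V) (p : ℤ), IsLatticeIn (Submodule.span R {algebraMap R K ϖ ^ p • x})
      (Submodule.span K {x}) := by
    intro x p
    have h2 := isLatticeIn_span (R := R) (K := K)
      (fun _ : Unit => algebraMap R K ϖ ^ p • x) (Submodule.span K {x}) (by
        rw [Set.range_const]
        exact Submodule.span_singleton_smul_eq (algebraMap_zpow_ne_zero hϖ p).isUnit x)
    rwa [Set.range_const] at h2
  rw [← h.span_triple]
  exact (IsLatticeIn.sup ⟨h.fg, rfl⟩ (h1 x₁ p)).sup (h1 x₂ q)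

/-- The vertices of the half-geodesic from `{N + R x₁ + ϖ^q R x₂}` to the boundary vertex of
`K x₂`. -/
theorem IsFrame.mem_halfGeodesic [IsDiscreteValuationRing R] (hϖ : Irreducible ϖ)
    (h : IsFrame N x₁ x₂ f₁ f₂) (p q : ℤ) (m : ℕ) :
    vertex _ (h.isLatticeIn_frameLattice hϖ p (q - m)) ∈
      halfGeodesic hϖ (vertex _ (h.isLatticeIn_frameLattice hϖ p q)) (Submodule.span K {x₂}) := by
  obtain ⟨w, i₁, i₂, hne, -, hw₂, hw⟩ := h.exists_basis (ϖ := ϖ)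
  refine ⟨w, {i₂}, fun i => if i = i₁ then p else if i = i₂ then q else 0, m, ?_, ?_, ?_⟩
  · rw [Set.image_singleton, hw₂]
  · exact vertex_congr (hw p q).symm
  · refine vertex_congr ?_
    rw [← hw p (q - m)]
    congr 2
    funext i
    congr 2
    by_cases h2 : i = i₂
    · simp [h2, hne.symm]
    · simp [h2]

/-- Because `0 ≤ q`, the lattice contains `ϖ^q x₁`, so the last generator may be replaced by `ϖ^q u
x₂`, of order `q + k`. -/
theorem IsFrame.frameLattice_add_smul_right (hϖ : Irreducible ϖ) (h : IsFrame N x₁ x₂ f₁ f₂)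
    {u : K} {k q : ℤ} (hu : HasOrder ϖ u k) (hq : 0 ≤ q) :
    frameLattice K ϖ N x₁ (x₁ + u • x₂) 0 q = frameLattice K ϖ N x₁ x₂ 0 (q + k) := by
  have hu0 := hu.ne_zero hϖ
  ext v
  rw [(h.add_smul_right hu0).mem_frameLattice, h.mem_frameLattice]
  simp only [LinearMap.sub_apply, LinearMap.smul_apply, smul_eq_mul]
  have h2 : u⁻¹ * f₂ v ∈ powIdeal K ϖ q ↔ f₂ v ∈ powIdeal K ϖ (q + k) := by
    refine ⟨fun h2 => ?_, fun h2 => hu.inv.mul_mem_powIdeal hϖ h2 (by ring)⟩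
    have h3 := hu.mul_mem_powIdeal hϖ h2 (q := q + k) (by ring)
    rwa [mul_inv_cancel_left₀ hu0] at h3
  have h3 : v - (f₁ v - u⁻¹ * f₂ v) • x₁ - (u⁻¹ * f₂ v) • (x₁ + u • x₂) =
      v - f₁ v • x₁ - f₂ v • x₂ := by
    rw [smul_add, smul_smul, mul_right_comm, inv_mul_cancel₀ hu0, one_mul]
    module
  rw [h2, h3, ← and_assoc, ← and_assoc]
  refine and_congr_left fun _ => and_congr_left fun h4 => ?_
  exact Submodule.sub_mem_iff_left _ (powIdeal_mono hϖ hq (h2.2 h4))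

/-! ### Distances and closest vertices on the geodesic -/

section Geodesic

variable [IsDiscreteValuationRing R] {γ : ℤ → Vertex R K V}

/-- The inclusions along the walk are tested on `x₁` and `x₂` only. The `x₁` axis controls the order
of the scalar `c` between the representatives, and the `x₂` axis then controls `j - i`. -/
theorem IsFrame.abs_sub_le_length (hϖ : Irreducible ϖ) (h : IsFrame N x₁ x₂ f₁ f₂)
    (hγ : ∀ j, γ j = vertex _ (h.isLatticeIn_frameLattice hϖ 0 (-j))) {i j : ℤ}
    (p : (skeleton R K V).Walk (γ i) (γ j)) : |j - i| ≤ p.length := by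
  have h0 : algebraMap R K ϖ ≠ 0 := by simpa using hϖ.ne_zero
  obtain ⟨L', hL', h', hle, hsmul⟩ :=
    BruhatTits.exists_lattice_of_walk hϖ.maximalIdeal_eq h0 p (hγ i)
  rw [hγ j] at h'
  obtain ⟨c, hc, rfl⟩ := vertex_eq_iff.1 h'
  obtain ⟨e, he⟩ := exists_hasOrder hϖ hc
  have hx₁ : ∀ {t : K} {q : ℤ}, t • x₁ ∈ frameLattice K ϖ N x₁ x₂ 0 q ↔ t ∈ powIdeal K ϖ 0 := by
    intro t q
    rw [h.mem_frameLattice]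
    simp [h.f₁_x₁, h.f₂_x₁]
  have hx₂ : ∀ {t : K} {q : ℤ}, t • x₂ ∈ frameLattice K ϖ N x₁ x₂ 0 q ↔ t ∈ powIdeal K ϖ q := by
    intro t q
    rw [h.mem_frameLattice]
    simp [h.f₁_x₂, h.f₂_x₂]
  have hd := hasOrder_zpow (K := K) ϖ p.length
  have e1 : e ≤ 0 := by
    have h1 := hle (hx₁.2 (((hasOrder_zpow ϖ 0).mem_powIdeal_iff hϖ).2 le_rfl))
    rw [mem_smul_iff hc, smul_smul, hx₁,
      (he.inv.mul hϖ (hasOrder_zpow ϖ 0)).mem_powIdeal_iff hϖ] at h1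
    omega
  have e2 : -j ≤ -e - i := by
    have h1 := hle (hx₂.2 (((hasOrder_zpow ϖ (-i)).mem_powIdeal_iff hϖ).2 le_rfl))
    rw [mem_smul_iff hc, smul_smul, hx₂,
      (he.inv.mul hϖ (hasOrder_zpow ϖ (-i))).mem_powIdeal_iff hϖ] at h1
    omega
  have e3 : 0 ≤ p.length + e := by
    have h1 := hsmul _ (Submodule.smul_mem_pointwise_smul _ c _
      (hx₁.2 (((hasOrder_zpow ϖ 0).mem_powIdeal_iff hϖ).2 le_rfl)))
    rw [← zpow_natCast, smul_smul, smul_smul, hx₁,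
      ((hd.mul hϖ he).mul hϖ (hasOrder_zpow ϖ 0)).mem_powIdeal_iff hϖ] at h1
    omega
  have e4 : -i ≤ p.length + e - j := by
    have h1 := hsmul _ (Submodule.smul_mem_pointwise_smul _ c _
      (hx₂.2 (((hasOrder_zpow ϖ (-j)).mem_powIdeal_iff hϖ).2 le_rfl)))
    rw [← zpow_natCast, smul_smul, smul_smul, hx₂,
      ((hd.mul hϖ he).mul hϖ (hasOrder_zpow ϖ (-j))).mem_powIdeal_iff hϖ] at h1
    omega
  rw [abs_le]
  constructor <;> omega

theorem IsFrame.geodesic_injective (hϖ : Irreducible ϖ) (h : IsFrame N x₁ x₂ f₁ f₂)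
    (hγ : ∀ j, γ j = vertex _ (h.isLatticeIn_frameLattice hϖ 0 (-j))) : Function.Injective γ := by
  intro i j hij
  -- Equal vertices are joined by a walk of length zero.
  have h1 := h.abs_sub_le_length hϖ hγ (SimpleGraph.Walk.nil.copy rfl hij : _)
  rw [SimpleGraph.Walk.length_copy, SimpleGraph.Walk.length_nil, abs_le] at h1
  omega

theorem IsFrame.geodesic_adj (hϖ : Irreducible ϖ) (h : IsFrame N x₁ x₂ f₁ f₂)
    (hγ : ∀ j, γ j = vertex _ (h.isLatticeIn_frameLattice hϖ 0 (-j))) (j : ℤ) :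
    (skeleton R K V).Adj (γ j) (γ (j + 1)) := by
  rw [skeleton, SimpleGraph.fromRel_adj]
  refine ⟨fun h1 => ?_, Or.inl ⟨_, _, _, _, (hγ j).symm, (hγ (j + 1)).symm, ?_, fun v hv => ?_⟩⟩
  · have := h.geodesic_injective hϖ hγ h1
    omega
  · rw [hϖ.maximalIdeal_eq, Submodule.ideal_span_singleton_smul]
    intro v hv
    obtain ⟨v, hv', rfl⟩ := (Submodule.mem_smul_pointwise_iff_exists _ _ _).1 hv
    obtain ⟨h1, h2, h3⟩ := h.mem_frameLattice.1 hv'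
    have hone : HasOrder ϖ (algebraMap R K ϖ) 1 := by simpa using hasOrder_zpow (K := K) ϖ 1
    rw [← algebraMap_smul K ϖ, h.mem_frameLattice]
    simp only [map_smul, smul_eq_mul]
    refine ⟨powIdeal_mono hϖ (by norm_num) (hone.mul_mem_powIdeal hϖ h1 rfl),
      hone.mul_mem_powIdeal hϖ h2 (by ring), ?_⟩
    have h4 := N.smul_mem ϖ h3
    rwa [← algebraMap_smul K ϖ, smul_sub, smul_sub, smul_smul, smul_smul] at h4
  · obtain ⟨h1, h2, h3⟩ := h.mem_frameLattice.1 hv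
    exact h.mem_frameLattice.2 ⟨h1, powIdeal_mono hϖ (by omega) h2, h3⟩

theorem IsFrame.exists_walk (hϖ : Irreducible ϖ) (h : IsFrame N x₁ x₂ f₁ f₂)
    (hγ : ∀ j, γ j = vertex _ (h.isLatticeIn_frameLattice hϖ 0 (-j))) (i : ℤ) (m : ℕ) :
    ∃ p : (skeleton R K V).Walk (γ i) (γ (i + m)), p.length = m := by
  induction m with
  | zero => exact ⟨SimpleGraph.Walk.nil.copy rfl (by simp), by simp⟩
  | succ m ih =>
    obtain ⟨p, hp⟩ := ih
    refine ⟨(p.concat (h.geodesic_adj hϖ hγ (i + m))).copy rfl (by push_cast; rw [add_assoc]), ?_⟩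
    simp [hp]

theorem IsFrame.dist_geodesic (hϖ : Irreducible ϖ) (h : IsFrame N x₁ x₂ f₁ f₂)
    (hγ : ∀ j, γ j = vertex _ (h.isLatticeIn_frameLattice hϖ 0 (-j))) {i j : ℤ} (hij : i ≤ j) :
    (dist (γ i) (γ j) : ℤ) = j - i := by
  obtain ⟨m, rfl⟩ : ∃ m : ℕ, j = i + m := ⟨(j - i).toNat, by omega⟩
  obtain ⟨p, hp⟩ := h.exists_walk hϖ hγ i m
  have h1 : dist (γ i) (γ (i + m)) ≤ m :=
    (SimpleGraph.dist_le p).trans_eq hp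
  obtain ⟨p', hp'⟩ := p.reachable.exists_walk_length_eq_dist
  have h2 := h.abs_sub_le_length hϖ hγ p'
  rw [hp', add_sub_cancel_left, Nat.abs_cast] at h2
  rw [add_sub_cancel_left]
  exact le_antisymm (by exact_mod_cast h1) h2

theorem IsFrame.distor_geodesic (hϖ : Irreducible ϖ) (h : IsFrame N x₁ x₂ f₁ f₂)
    (hγ : ∀ j, γ j = vertex _ (h.isLatticeIn_frameLattice hϖ 0 (-j))) (i j : ℤ) :
    distor γ (γ i) (γ j) = j - i := by
  have hinj := h.geodesic_injective hϖ hγ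
  rw [distor]
  split_ifs with hij
  · obtain ⟨i', j', hle, hi, hj⟩ := hij
    rw [← hinj hi, ← hinj hj]
    exact h.dist_geodesic hϖ hγ hle
  · have hle : j ≤ i := by
      by_contra! hlt
      exact hij ⟨i, j, hlt.le, rfl, rfl⟩
    have h1 := h.dist_geodesic hϖ hγ hle
    rw [dist, SimpleGraph.dist_comm] at h1
    rw [dist, h1, neg_sub]

theorem IsFrame.isClosestVertex (hϖ : Irreducible ϖ) (h : IsFrame N x₁ x₂ f₁ f₂)
    (hγ : ∀ j, γ j = vertex _ (h.isLatticeIn_frameLattice hϖ 0 (-j))) {u : K} {k : ℤ}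
    (hu : HasOrder ϖ u k) :
    IsClosestVertex hϖ γ (Submodule.span K {x₁ + u • x₂}) (γ (-k)) := by
  have hu0 := hu.ne_zero hϖ
  refine ⟨-k, rfl, ?_, fun i hi => ?_⟩
  · refine Set.Subset.antisymm ?_ (Set.singleton_subset_iff.2 ⟨?_, Set.mem_range_self _⟩)
    · rintro _ ⟨hy, i, rfl⟩
      rw [hγ (-k)] at hy
      obtain ⟨m, hm, hym⟩ := exists_eq_of_mem_halfGeodesic hϖ hy
      have hL := hγ (-k)
      simp only [neg_neg] at hym hL hm
      rw [hγ i] at hym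
      obtain ⟨c, hc, hcL⟩ := vertex_eq_iff.1 hym
      set L := frameLattice K ϖ N x₁ x₂ 0 k
      have hϖm := hasOrder_zpow (K := K) ϖ (-m)
      have hϖm0 := hϖm.ne_zero hϖ
      have h1 : x₁ + u • x₂ ∈ L := by
        refine h.mem_frameLattice.2 ?_
        simp only [map_add, map_smul, h.f₁_x₁, h.f₁_x₂, h.f₂_x₁, h.f₂_x₂, smul_eq_mul, mul_zero,
          add_zero, mul_one, zero_add, one_smul, add_sub_cancel_left, sub_self]
        refine ⟨?_, (hu.mem_powIdeal_iff hϖ).2 le_rfl, N.zero_mem⟩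
        simpa using (hasOrder_zpow (K := K) ϖ 0).mem_powIdeal_iff hϖ (p := 0)
      have h2 : algebraMap R K ϖ ^ (-m : ℤ) • (x₁ + u • x₂) ∈
          L ⊔ algebraMap R K ϖ ^ (-m : ℤ) •
            (L ⊓ (Submodule.span K {x₁ + u • x₂}).restrictScalars R) :=
        Submodule.mem_sup_right (Submodule.smul_mem_pointwise_smul _ _ _
          ⟨h1, Submodule.mem_span_singleton_self _⟩)
      -- A multiple of a frame lattice contains the components of its elements along the axes. Thus,
      -- if the `m`-th vertex lies on `γ`, its lattice contains `ϖ^{-m} x₁` along with `ϖ^{-m}(x₁ +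
      -- u x₂)`.
      have h3 : algebraMap R K ϖ ^ (-m : ℤ) • x₁ ∈
          L ⊔ algebraMap R K ϖ ^ (-m : ℤ) •
            (L ⊓ (Submodule.span K {x₁ + u • x₂}).restrictScalars R) := by
        rw [hcL, mem_smul_iff hc, smul_smul, h.mem_frameLattice] at h2 ⊢
        simpa [h.f₁_x₁, h.f₁_x₂, h.f₂_x₁, h.f₂_x₂] using h2.1
      have hm0 : m = 0 := by
        obtain ⟨l, hl, z, hz, hlz⟩ := Submodule.mem_sup.1 h3
        rw [mem_smul_iff hϖm0] at hz
        obtain ⟨t, ht⟩ := Submodule.mem_span_singleton.1 hz.2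
        have hz' : z = algebraMap R K ϖ ^ (-m : ℤ) • t • (x₁ + u • x₂) := by
          rw [ht, smul_inv_smul₀ hϖm0]
        obtain ⟨l1, l2, -⟩ := h.mem_frameLattice.1 hl
        have e1 := congrArg f₁ hlz
        have e2 := congrArg f₂ hlz
        simp only [hz', map_add, map_smul, h.f₁_x₁, h.f₁_x₂, h.f₂_x₁, h.f₂_x₂, smul_eq_mul,
          mul_zero, add_zero, mul_one, zero_add] at e1 e2
        -- The functional `f₁ - u⁻¹ f₂` kills `x₁ + u x₂` and is integral on `L`, since `f₂` takes
        -- values in `ϖ^k R` there. Hence `ϖ^{-m}` is integral and `m = 0`.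
        have e3 : algebraMap R K ϖ ^ (-m : ℤ) = f₁ l - u⁻¹ * f₂ l := by
          rw [← e1, eq_neg_of_add_eq_zero_left e2]
          field_simp
          ring
        have e4 : algebraMap R K ϖ ^ (-m : ℤ) ∈ powIdeal K ϖ 0 := by
          rw [e3]
          exact Submodule.sub_mem _ l1 (hu.inv.mul_mem_powIdeal hϖ l2 (by ring))
        rw [hϖm.mem_powIdeal_iff hϖ] at e4
        omega
      rw [Set.mem_singleton_iff, hγ i, hym, hL]
      refine vertex_congr ?_
      rw [hm0]
      simp
    · have h1 := (h.add_smul_left u).swap.mem_halfGeodesic hϖ k 0 0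
      have h2 : γ (-k) = vertex _ ((h.add_smul_left u).swap.isLatticeIn_frameLattice hϖ k 0) := by
        rw [hγ]
        refine vertex_congr ?_
        rw [neg_neg]
        exact ((frameLattice_swap ϖ 0 k).trans (h.frameLattice_add_smul_left hϖ hu le_rfl)).symm
      rw [h2]
      simpa using h1
  · by_contra! hlt
    -- Before `-k`, the vertex `γ i` has exponent `m + 1` in the frame `x₁`, `x₁ + u x₂`. One step
    -- of the half-geodesic leaves the exponent `m ≥ 0`, which is still on `γ`, at `γ (i + 1)`.
    -- Vertices after `-k` need no check, as only minimality is claimed.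
    obtain ⟨m, hm⟩ : ∃ m : ℕ, -i = m + 1 + k := ⟨(-i - 1 - k).toNat, by omega⟩
    have hf := h.add_smul_right hu0
    have h1 := hf.mem_halfGeodesic hϖ 0 (m + 1) 1
    have h2 : γ i = vertex _ (hf.isLatticeIn_frameLattice hϖ 0 (m + 1)) := by
      rw [hγ]
      refine vertex_congr ?_
      rw [h.frameLattice_add_smul_right hϖ hu (by omega), hm]
    have h3 : γ (i + 1) = vertex _ (hf.isLatticeIn_frameLattice hϖ 0 (m + 1 - (1 : ℕ))) := by
      rw [hγ]
      refine vertex_congr ?_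
      rw [h.frameLattice_add_smul_right hϖ hu (by omega)]
      congr 1
      push_cast
      omega
    rw [← h2, ← h3] at h1
    have h4 : γ (i + 1) ∈ ({γ i} : Set (Vertex R K V)) := by
      rw [← hi]
      exact ⟨h1, Set.mem_range_self _⟩
    have := h.geodesic_injective hϖ hγ h4
    omega

end Geodesic

end Frame

end BruhatTits

/-! ### The pairing as the order of a cross ratio -/

namespace ProjectiveModel

open BruhatTits

variable {R K V : Type*} [CommRing R] [IsDomain R] [IsDiscreteValuationRing R] [Field K]
  [Algebra R K] [IsFractionRing R K] [AddCommGroup V] [Module K V] {n : ℕ}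

/-- Divide by a nonzero coordinate of least order. -/
theorem exists_primitive_multiple {x : Fin n → K} (hx : x ≠ 0) :
    ∃ (s : K) (α : Fin n → R) (i₀ : Fin n), s ≠ 0 ∧ α i₀ = 1 ∧
      ∀ i, algebraMap R K (α i) = s * x i := by
  classical
  obtain ⟨ϖ, hϖ⟩ := IsDiscreteValuationRing.exists_irreducible R
  have hk : ∀ i, ∃ k, x i ≠ 0 → HasOrder ϖ (x i) k := by
    intro i
    by_cases hi : x i = 0
    · exact ⟨0, fun h => absurd hi h⟩
    · exact (exists_hasOrder hϖ hi).imp fun _ h _ => h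
  choose k hk using hk
  obtain ⟨i₁, hi₁⟩ := Function.ne_iff.1 hx
  obtain ⟨i₀, hi₀, hmin⟩ := (Finset.univ.filter fun i => x i ≠ 0).exists_min_image k
    ⟨i₁, by simpa using hi₁⟩
  have h0 : x i₀ ≠ 0 := by simpa using hi₀
  have hα : ∀ i, ∃ a : R, algebraMap R K a = (x i₀)⁻¹ * x i := by
    intro i
    by_cases hi : x i = 0
    · exact ⟨0, by simp [hi]⟩
    · refine mem_powIdeal_zero.1 ((((hk i₀ h0).inv.mul hϖ (hk i hi)).mem_powIdeal_iff hϖ).2 ?_)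
      have := hmin i (by simpa using hi)
      omega
  choose α hα using hα
  refine ⟨(x i₀)⁻¹, α, i₀, inv_ne_zero h0, IsFractionRing.injective R K ?_, hα⟩
  rw [hα, inv_mul_cancel₀ h0, map_one]

/-- For primitive multiples of a vector `v` and of a linear form `φ`, the intersection number of
the closures of `ℙ(K v)` and `ℙ(ker φ)` is the order of `φ(v)`. -/
theorem intersectionNumber_eq_of_hasOrder [Infinite K] {ϖ : R} (hϖ : Irreducible ϖ)
    (e : Module.Basis (Fin n) K V) {v : V} {φ : V →ₗ[K] K} {s t : K} {α c : Fin n → R}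
    {i₀ j₀ : Fin n} (hs : s ≠ 0) (ht : t ≠ 0) (hα : α i₀ = 1) (hc : c j₀ = 1)
    (hαv : ∀ i, algebraMap R K (α i) = s * e.repr v i)
    (hcφ : ∀ i, algebraMap R K (c i) = t * φ (e i)) {k : ℤ} (hk : HasOrder ϖ (t * s * φ v) k) :
    (intersectionNumber R e (Submodule.span K {v}) (LinearMap.ker φ) : ℤ) = k := by
  have hφ : ∀ z : V, φ z = ∑ i, e.repr z i * φ (e i) := by
    intro z
    conv_lhs => rw [← e.sum_repr z, map_sum]
    simp
  have hsum : algebraMap R K (∑ i, c i * α i) = t * s * φ v := by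
    rw [map_sum, hφ, Finset.mul_sum]
    refine Finset.sum_congr rfl fun i _ => ?_
    rw [map_mul, hαv, hcφ]
    ring
  have hA : Submodule.span K {v} = Submodule.span K {∑ i, algebraMap R K (α i) • e i} := by
    simp_rw [hαv, mul_smul, ← Finset.smul_sum]
    rw [e.sum_repr, Submodule.span_singleton_smul_eq hs.isUnit]
  have hC : ∀ z, z ∈ LinearMap.ker φ ↔ ∑ i, algebraMap R K (c i) * e.repr z i = 0 := by
    intro z
    have h1 : ∑ i, algebraMap R K (c i) * e.repr z i = t * φ z := by
      rw [hφ, Finset.mul_sum]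
      refine Finset.sum_congr rfl fun i _ => ?_
      rw [hcφ]
      ring
    rw [h1, LinearMap.mem_ker, mul_eq_zero, or_iff_right ht]
  rw [← hsum] at hk
  rw [intersectionNumber_eq hα hc hA hC]
  · exact hk.toNat_ord hϖ
  · intro h0
    exact hk.ne_zero hϖ (by rw [h0, map_zero])

/-- The pairing is the order of a cross ratio. -/
theorem localPairing_eq_of_hasOrder [Infinite K] {ϖ : R} (hϖ : Irreducible ϖ)
    (e : Module.Basis (Fin n) K V) {v w : V} {φ ψ : V →ₗ[K] K} (hφv : φ v ≠ 0) (hφw : φ w ≠ 0)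
    (hψv : ψ v ≠ 0) (hψw : ψ w ≠ 0) {k : ℤ}
    (hk : HasOrder ϖ (φ v * ψ w / (φ w * ψ v)) k) :
    localPairing R e (Submodule.span K {v}) (Submodule.span K {w}) (LinearMap.ker φ)
      (LinearMap.ker ψ) = k := by
  have hvec : ∀ z : V, z ≠ 0 → (fun i => e.repr z i) ≠ 0 := by
    intro z hz h
    exact hz (e.repr.map_eq_zero_iff.1 (Finsupp.ext (congrFun h)))
  have hform : ∀ (θ : V →ₗ[K] K) (z : V), θ z ≠ 0 → (fun i => θ (e i)) ≠ 0 := by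
    intro θ z hz h
    exact hz (by rw [e.ext (f₁ := θ) (f₂ := 0) (fun i => congrFun h i), LinearMap.zero_apply])
  obtain ⟨s, α, i₀, hs, hα, hαv⟩ :=
    exists_primitive_multiple (R := R) (hvec v fun h => hφv (by simp [h]))
  obtain ⟨s', β, i₁, hs', hβ, hβw⟩ :=
    exists_primitive_multiple (R := R) (hvec w fun h => hφw (by simp [h]))
  obtain ⟨t, c, j₀, ht, hc, hcφ⟩ := exists_primitive_multiple (R := R) (hform φ v hφv)
  obtain ⟨t', d, j₁, ht', hd, hdψ⟩ := exists_primitive_multiple (R := R) (hform ψ v hψv)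
  obtain ⟨k₁, h₁⟩ := exists_hasOrder hϖ (mul_ne_zero (mul_ne_zero ht hs) hφv)
  obtain ⟨k₂, h₂⟩ := exists_hasOrder hϖ (mul_ne_zero (mul_ne_zero ht' hs) hψv)
  obtain ⟨k₃, h₃⟩ := exists_hasOrder hϖ (mul_ne_zero (mul_ne_zero ht hs') hφw)
  obtain ⟨k₄, h₄⟩ := exists_hasOrder hϖ (mul_ne_zero (mul_ne_zero ht' hs') hψw)
  rw [localPairing, intersectionNumber_eq_of_hasOrder hϖ e hs ht hα hc hαv hcφ h₁,
    intersectionNumber_eq_of_hasOrder hϖ e hs ht' hα hd hαv hdψ h₂,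
    intersectionNumber_eq_of_hasOrder hϖ e hs' ht hβ hc hβw hcφ h₃,
    intersectionNumber_eq_of_hasOrder hϖ e hs' ht' hβ hd hβw hdψ h₄]
  -- Each of the factors `s`, `s'`, `t`, `t'` occurs once above and once below, so the dependence on
  -- the basis `e` disappears.
  have h5 := (h₁.mul hϖ h₄).div hϖ (h₃.mul hϖ h₂)
  have h6 : t * s * φ v * (t' * s' * ψ w) / (t * s' * φ w * (t' * s * ψ v)) =
      φ v * ψ w / (φ w * ψ v) := by
    field_simp
  rw [h6] at h5
  have := h5.unique hϖ hk
  omega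

end ProjectiveModel

/-! ### Linear algebra in the plane of two points -/

namespace BruhatTits

theorem exists_eq_ker {K V : Type*} [Field K] [AddCommGroup V] [Module K V] {C : Submodule K V}
    (hC : Module.finrank K (V ⧸ C) = 1) : ∃ φ : V →ₗ[K] K, C = LinearMap.ker φ := by
  have : Module.Finite K (V ⧸ C) := Module.finite_of_finrank_pos (by omega)
  let f : (V ⧸ C) ≃ₗ[K] K := LinearEquiv.ofFinrankEq _ _ (by rw [hC, Module.finrank_self])
  refine ⟨f.toLinearMap ∘ₗ C.mkQ, ?_⟩
  rw [LinearEquiv.ker_comp, Submodule.ker_mkQ]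

variable {K V : Type*} [Field K] [AddCommGroup V] [Module K V] {v w : V} {φ ψ : V →ₗ[K] K}

/-- The vector `φ(w) v - φ(v) w` of the plane is killed by `φ`, hence also by `ψ`. -/
theorem mul_eq_mul_of_inf_ker_eq
    (h : (Submodule.span K {v} ⊔ Submodule.span K {w}) ⊓ LinearMap.ker φ =
      (Submodule.span K {v} ⊔ Submodule.span K {w}) ⊓ LinearMap.ker ψ) :
    φ v * ψ w = φ w * ψ v := by
  have h1 : φ w • v - φ v • w ∈
      (Submodule.span K {v} ⊔ Submodule.span K {w}) ⊓ LinearMap.ker φ :=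
    ⟨Submodule.sub_mem _
      (Submodule.mem_sup_left (Submodule.smul_mem _ _ (Submodule.mem_span_singleton_self v)))
      (Submodule.mem_sup_right (Submodule.smul_mem _ _ (Submodule.mem_span_singleton_self w))),
      by simp [mul_comm]⟩
  rw [h] at h1
  have h2 : ψ (φ w • v - φ v • w) = 0 := h1.2
  rw [map_sub, map_smul, map_smul, smul_eq_mul, smul_eq_mul, sub_eq_zero] at h2
  exact h2.symm

/-- A hyperplane meets the plane that two points outside of it span in a line. -/
theorem exists_inf_ker_eq_span (hvw : Submodule.span K {v} ≠ Submodule.span K {w})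
    (hv : φ v ≠ 0) (hw : φ w ≠ 0) :
    ∃ x, x ≠ 0 ∧ (Submodule.span K {v} ⊔ Submodule.span K {w}) ⊓ LinearMap.ker φ =
      Submodule.span K {x} := by
  refine ⟨φ w • v - φ v • w, fun h => hvw ?_, le_antisymm ?_ ?_⟩
  · rw [sub_eq_zero] at h
    rw [← Submodule.span_singleton_smul_eq hw.isUnit v, h,
      Submodule.span_singleton_smul_eq hv.isUnit w]
  · rintro z ⟨hz, hzφ⟩
    rw [SetLike.mem_coe, ← Submodule.span_insert, Submodule.mem_span_pair] at hz
    obtain ⟨s, t, rfl⟩ := hz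
    have h1 : s * φ v + t * φ w = 0 := by simpa using hzφ
    refine Submodule.mem_span_singleton.2 ⟨s / φ w, ?_⟩
    have h2 : s / φ w * φ v = -t := by
      field_simp
      linear_combination h1
    rw [smul_sub, smul_smul, smul_smul, div_mul_cancel₀ _ hw, h2]
    module
  · rw [Submodule.span_singleton_le_iff_mem]
    exact ⟨Submodule.sub_mem _
      (Submodule.mem_sup_left (Submodule.smul_mem _ _ (Submodule.mem_span_singleton_self v)))
      (Submodule.mem_sup_right (Submodule.smul_mem _ _ (Submodule.mem_span_singleton_self w))),
      by simp [mul_comm]⟩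

theorem apply_ne_zero_of_span_eq {U : Submodule K V} {x₁ x₂ : V} (hx₁ : x₁ ≠ 0)
    (h₁ : U ⊓ LinearMap.ker φ = Submodule.span K {x₁})
    (h₂ : U ⊓ LinearMap.ker ψ = Submodule.span K {x₂})
    (hne : U ⊓ LinearMap.ker φ ≠ U ⊓ LinearMap.ker ψ) : ψ x₁ ≠ 0 := by
  intro h
  have h3 : x₁ ∈ U ⊓ LinearMap.ker ψ :=
    ⟨(h₁ ▸ Submodule.mem_span_singleton_self x₁ : x₁ ∈ U ⊓ LinearMap.ker φ).1, h⟩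
  rw [h₂] at h3
  obtain ⟨t, rfl⟩ := Submodule.mem_span_singleton.1 h3
  have ht : t ≠ 0 := fun h => hx₁ (by rw [h, zero_smul])
  exact hne (by rw [h₁, h₂, Submodule.span_singleton_smul_eq ht.isUnit])

theorem isFrame_of_inf_ker_eq_span {R : Type*} [CommRing R] [Algebra R K] [Module R V]
    [IsScalarTower R K V] {N : Submodule R V}
    (hN : IsLatticeIn N (LinearMap.ker φ ⊓ LinearMap.ker ψ)) {x₁ x₂ : V} (hφ₁ : φ x₁ = 0)
    (hψ₂ : ψ x₂ = 0) (hψ₁ : ψ x₁ ≠ 0) (hφ₂ : φ x₂ ≠ 0) :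
    IsFrame N x₁ x₂ ((ψ x₁)⁻¹ • ψ) ((φ x₂)⁻¹ • φ) := by
  refine ⟨hN.1, ?_, ?_, ?_, ?_, ?_⟩
  · rw [hN.2, LinearMap.ker_smul _ _ (inv_ne_zero hψ₁), LinearMap.ker_smul _ _ (inv_ne_zero hφ₂),
      inf_comm]
  all_goals simp [hφ₁, hψ₂, hψ₁, hφ₂]

/-- The coordinates of `z` are `ψ z / ψ x₁` and `φ z / φ x₂`: the remainder is a multiple of `x₁`
killed by `ψ`, hence zero. The parameter of the line is the ratio of the two. -/
theorem span_singleton_eq_of_mem {U : Submodule K V} {x₁ x₂ z : V} (hx₁ : x₁ ∈ U) (hx₂ : x₂ ∈ U)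
    (h₁ : U ⊓ LinearMap.ker φ = Submodule.span K {x₁}) (hφ₁ : φ x₁ = 0)
    (hψ₂ : ψ x₂ = 0) (hψ₁ : ψ x₁ ≠ 0) (hφ₂ : φ x₂ ≠ 0) (hz : z ∈ U) (hψz : ψ z ≠ 0) :
    Submodule.span K {z} =
      Submodule.span K {x₁ + (φ z * ψ x₁ / (φ x₂ * ψ z)) • x₂} := by
  have h3 : z - (ψ z / ψ x₁) • x₁ - (φ z / φ x₂) • x₂ ∈ U ⊓ LinearMap.ker φ :=
    ⟨U.sub_mem (U.sub_mem hz (U.smul_mem _ hx₁)) (U.smul_mem _ hx₂), by simp [hφ₁, hφ₂]⟩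
  rw [h₁] at h3
  obtain ⟨t, ht⟩ := Submodule.mem_span_singleton.1 h3
  have h4 : t = 0 := by
    have := congrArg ψ ht
    simpa [hψ₁, hψ₂] using this
  rw [h4, zero_smul, eq_comm, sub_sub, sub_eq_zero] at ht
  have h5 : z = (ψ z / ψ x₁) • (x₁ + (φ z * ψ x₁ / (φ x₂ * ψ z)) • x₂) := by
    rw [smul_add, smul_smul]
    conv_lhs => rw [ht]
    congr 2
    field_simp
  conv_lhs => rw [h5]
  exact Submodule.span_singleton_smul_eq (div_ne_zero hψz hψ₁).isUnit _

end BruhatTits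

end

/-! ### Comparison of the two sides -/

theorem corollary3p2 {K V : Type*} [Field K] [ValuativeRel K] [TopologicalSpace K]
    [IsNonarchimedeanLocalField K] [CharZero K] [AddCommGroup V] [Module K V]
    {n : ℕ} (e : Module.Basis (Fin n) K V)
    (a b : ℙ K V) (hab : a ≠ b)
    (C D : Submodule K V) (hC : Module.finrank K (V ⧸ C) = 1) (hD : Module.finrank K (V ⧸ D) = 1)
    (hCD : C ≠ D)
    (haC : ¬ a.submodule ≤ C) (haD : ¬ a.submodule ≤ D)
    (hbC : ¬ b.submodule ≤ C) (hbD : ¬ b.submodule ≤ D) :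
    ((a.submodule ⊔ b.submodule) ⊓ C = (a.submodule ⊔ b.submodule) ⊓ D →
      ProjectiveModel.localPairing 𝒪[K] e a.submodule b.submodule C D = 0) ∧
    ((a.submodule ⊔ b.submodule) ⊓ C ≠ (a.submodule ⊔ b.submodule) ⊓ D →
      ∀ (ϖ : 𝒪[K]) (hϖ : Irreducible ϖ) (N M₁ M₂ : Submodule 𝒪[K] V),
        BruhatTits.IsLatticeIn N (C ⊓ D) →
        BruhatTits.IsLatticeIn M₁ ((a.submodule ⊔ b.submodule) ⊓ C) →
        ∀ hM₂ : BruhatTits.IsLatticeIn M₂ ((a.submodule ⊔ b.submodule) ⊓ D),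
        Disjoint N M₁ ∧
        ∃ (hL : BruhatTits.IsLatticeIn (N ⊔ M₁) C)
          (hW : IsCompl C ((a.submodule ⊔ b.submodule) ⊓ D))
          (x y : BruhatTits.Vertex 𝒪[K] K V),
          BruhatTits.IsClosestVertex hϖ (BruhatTits.geodesic hϖ hW hL hM₂) a.submodule x ∧
          BruhatTits.IsClosestVertex hϖ (BruhatTits.geodesic hϖ hW hL hM₂) b.submodule y ∧
          ProjectiveModel.localPairing 𝒪[K] e a.submodule b.submodule C D =
            BruhatTits.distor (BruhatTits.geodesic hϖ hW hL hM₂) x y) := by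
  have hinf : Infinite K := inferInstance
  obtain ⟨φ, rfl⟩ := BruhatTits.exists_eq_ker hC
  obtain ⟨ψ, rfl⟩ := BruhatTits.exists_eq_ker hD
  have habs : a.submodule ≠ b.submodule := fun h => hab (Projectivization.submodule_injective h)
  rw [a.submodule_eq] at habs haC haD ⊢
  rw [b.submodule_eq] at habs hbC hbD ⊢
  rw [Submodule.span_singleton_le_iff_mem, LinearMap.mem_ker] at haC haD hbC hbD
  set v := a.rep
  set w := b.rep
  constructor
  · intro h
    obtain ⟨ϖ, hϖ⟩ := IsDiscreteValuationRing.exists_irreducible 𝒪[K]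
    refine ProjectiveModel.localPairing_eq_of_hasOrder hϖ e haC hbC haD hbD ?_
    rw [BruhatTits.mul_eq_mul_of_inf_ker_eq h, div_self (mul_ne_zero hbC haD)]
    simpa using BruhatTits.hasOrder_zpow (K := K) ϖ 0
  obtain ⟨y₁, hy₁, hU₁⟩ := BruhatTits.exists_inf_ker_eq_span habs haC hbC
  obtain ⟨y₂, hy₂, hU₂⟩ := BruhatTits.exists_inf_ker_eq_span habs haD hbD
  have hvU : v ∈ Submodule.span K {v} ⊔ Submodule.span K {w} :=
    Submodule.mem_sup_left (Submodule.mem_span_singleton_self v)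
  have hwU : w ∈ Submodule.span K {v} ⊔ Submodule.span K {w} :=
    Submodule.mem_sup_right (Submodule.mem_span_singleton_self w)
  set U := Submodule.span K {v} ⊔ Submodule.span K {w}
  intro hne ϖ hϖ N M₁ M₂ hN hM₁ hM₂
  obtain ⟨x₁, hx₁, hMx₁, hs₁⟩ := (hU₁ ▸ hM₁).exists_eq_span_singleton hy₁
  obtain ⟨x₂, hx₂, hMx₂, hs₂⟩ := (hU₂ ▸ hM₂).exists_eq_span_singleton hy₂
  rw [← hs₁] at hU₁
  rw [← hs₂] at hU₂
  have hψ₁ : ψ x₁ ≠ 0 := BruhatTits.apply_ne_zero_of_span_eq hx₁ hU₁ hU₂ hne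
  have hφ₂ : φ x₂ ≠ 0 := BruhatTits.apply_ne_zero_of_span_eq hx₂ hU₂ hU₁ hne.symm
  obtain ⟨hxU₁, hφ₁⟩ : x₁ ∈ U ⊓ LinearMap.ker φ := hU₁ ▸ Submodule.mem_span_singleton_self x₁
  obtain ⟨hxU₂, hψ₂⟩ : x₂ ∈ U ⊓ LinearMap.ker ψ := hU₂ ▸ Submodule.mem_span_singleton_self x₂
  have hframe := BruhatTits.isFrame_of_inf_ker_eq_span hN hφ₁ hψ₂ hψ₁ hφ₂
  have hspan : ∀ z ∈ U, ψ z ≠ 0 → Submodule.span K {z} =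
      Submodule.span K {x₁ + (φ z * ψ x₁ / (φ x₂ * ψ z)) • x₂} := fun z =>
    BruhatTits.span_singleton_eq_of_mem hxU₁ hxU₂ hU₁ hφ₁ hψ₂ hψ₁ hφ₂
  refine ⟨?_, ?_⟩
  · rw [Submodule.disjoint_def]
    intro z hz hz'
    rw [hMx₁] at hz'
    obtain ⟨t, rfl⟩ := Submodule.mem_span_singleton.1 hz'
    have h1 : ψ (t • x₁) = 0 := (hN.2 ▸ Submodule.subset_span hz :
      t • x₁ ∈ LinearMap.ker φ ⊓ LinearMap.ker ψ).2
    rw [← algebraMap_smul K t, map_smul, smul_eq_mul, mul_eq_zero, or_iff_left hψ₁] at h1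
    rw [← algebraMap_smul K t, h1, zero_smul]
  have hL : BruhatTits.IsLatticeIn (N ⊔ M₁) (LinearMap.ker φ) := by
    have h1 := hN.sup hM₁
    have h2 : LinearMap.ker φ ⊓ LinearMap.ker ψ ⊔ U ⊓ LinearMap.ker φ = LinearMap.ker φ := by
      refine le_antisymm (sup_le inf_le_left inf_le_right) fun z hz => ?_
      rw [← sub_add_cancel z ((ψ z / ψ x₁) • x₁)]
      have hz' : φ z = 0 := hz
      have hφ₁' : φ x₁ = 0 := hφ₁
      exact Submodule.add_mem_sup ⟨by simp [hz', hφ₁'], by simp [hψ₁]⟩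
        (Submodule.smul_mem _ _ ⟨hxU₁, hφ₁⟩)
    rwa [h2] at h1
  have hW : IsCompl (LinearMap.ker φ) (U ⊓ LinearMap.ker ψ) := by
    constructor
    · rw [Submodule.disjoint_def, hU₂]
      intro z hz hz'
      obtain ⟨t, rfl⟩ := Submodule.mem_span_singleton.1 hz'
      have h1 : t * φ x₂ = 0 := by simpa using hz
      rw [(mul_eq_zero.1 h1).resolve_right hφ₂, zero_smul]
    · rw [codisjoint_iff, eq_top_iff]
      intro z _
      rw [← sub_add_cancel z ((φ z / φ x₂) • x₂)]
      exact Submodule.add_mem_sup (by simp [hφ₂]) (Submodule.smul_mem _ _ ⟨hxU₂, hψ₂⟩)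
  have hγ : ∀ j, BruhatTits.geodesic hϖ hW hL hM₂ j =
      BruhatTits.vertex _ (hframe.isLatticeIn_frameLattice hϖ 0 (-j)) := by
    intro j
    refine BruhatTits.vertex_congr ?_
    rw [BruhatTits.frameLattice, zpow_zero, one_smul, ← hMx₁, hMx₂, Submodule.smul_span,
      Set.smul_set_singleton]
  -- `k` and `l` are the orders of the parameters of the lines of `v` and `w`. The closest vertices
  -- have indices `-k` and `-l`, so the oriented distance is `k - l`; the factors `ψ x₁` and `φ x₂`
  -- cancel in the quotient of the parameters.
  obtain ⟨k, hk⟩ := BruhatTits.exists_hasOrder hϖ (div_ne_zero (mul_ne_zero haC hψ₁)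
    (mul_ne_zero hφ₂ haD))
  obtain ⟨l, hl⟩ := BruhatTits.exists_hasOrder hϖ (div_ne_zero (mul_ne_zero hbC hψ₁)
    (mul_ne_zero hφ₂ hbD))
  refine ⟨hL, hW, BruhatTits.geodesic hϖ hW hL hM₂ (-k), BruhatTits.geodesic hϖ hW hL hM₂ (-l),
    ?_, ?_, ?_⟩
  · rw [hspan v hvU haD]
    exact hframe.isClosestVertex hϖ hγ hk
  · rw [hspan w hwU hbD]
    exact hframe.isClosestVertex hϖ hγ hl
  · rw [hframe.distor_geodesic hϖ hγ, neg_sub_neg]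
    refine ProjectiveModel.localPairing_eq_of_hasOrder hϖ e haC hbC haD hbD ?_
    convert hk.div hϖ hl using 1
    field_simp
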